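/- Let $G$ be a finite group and let $n$ be an integer with $0\le n\le 15$. A partial $G$-partition of $[n]=\{1,\dots,n\}$ consists of a subset $S\subseteq[n]$, a function $f\colon S\to G$, and a partition of $S$ into unordered nonempty blocks $A_1,\dots,A_k$; two of them, $(S,f,A_\bullet)$ and $(T,h,B_\bullet)$, are equivalent if $S=T$, the set partitions agree, and for every block $A_i$ there is $g_i\in G$ with $f|_{A_i}=g_i\cdot h|_{A_i}$. Order the equivalence classes by declaring that $x\le y$ if $y$ is obtained from $x$, up to equivalence, by a sequence of operations each of which merges blocks or deletes a block. The resulting poset is the lattice of flats of a simple matroid $\mathsf{Q}_n(G)$ of rank $n$, whose elements are the atoms of the poset (the Dowling geometry). For a loopless matroid $\mathsf{M}$, the Kazhdan--Lusztig polynomial $P_{\mathsf{M}}(t)\in\mathbb{Z}[t]$ and the $Z$-polynomial $Z_{\mathsf{M}}(t)$ are the unique polynomials such that $P_{\mathsf{M}}(t)=1$ if $\operatorname{rk}\mathsf{M}=0$; $\deg P_{\mathsf{M}}(t)<\tfrac12\operatorname{rk}\mathsf{M}$ if $\operatorname{rk}\mathsf{M}>0$; and, for every $\mathsf{M}$, $$Z_{\mathsf{M}}(t)=\sum_{F}t^{\operatorname{rk}F}\,P_{\mathsf{M}/F}(t),$$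 the sum being over all flats $F$ of $\mathsf{M}$, is palindromic of degree $d=\operatorname{rk}\mathsf{M}$, that is, it has degree $d$ and $Z_{\mathsf{M}}(t)=t^{d}Z_{\mathsf{M}}(t^{-1})$. Then both polynomials $P_{\mathsf{Q}_n(G)}(t)$ and $Z_{\mathsf{Q}_n(G)}(t)$ are real-rooted, that is, all of their complex zeros are real. -/

import Mathlib

/-! ## Kazhdan–Lusztig polynomials and `Z`-polynomials of matroids -/

namespace Matroid

open Polynomial

variable {α : Type*}

/-- The rank of a matroid, as a natural number (meaningful for matroids of finite rank). -/
noncomputable def natRank (M : Matroid α) : ℕ := M.eRank.toNat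

/-- The rank of a set in a matroid, as a natural number (meaningful for sets of finite rank). -/
noncomputable def natRk (M : Matroid α) (F : Set α) : ℕ := (M.eRk F).toNat

/-- `∑_F t ^ rk F * P (M / F)`, the sum being over all flats `F` of `M`. -/
noncomputable def flatSum (P : Matroid α → ℤ[X]) (M : Matroid α) : ℤ[X] :=
  ∑ᶠ F : {F : Set α // M.IsFlat F}, X ^ M.natRk F.1 * P (M ／ F.1)

/-- The defining conditions of the Kazhdan–Lusztig polynomials of loopless matroids. A polynomial
is palindromic when it equals its `Polynomial.reverse`, that is `t ^ deg f * f (1 / t)`. -/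
structure IsKLAssignment (P : Matroid α → ℤ[X]) : Prop where
  rank_zero : ∀ M : Matroid α, M.Loopless → M.natRank = 0 → P M = 1
  degree_lt : ∀ M : Matroid α, M.Loopless → 0 < M.natRank → 2 * (P M).natDegree < M.natRank
  natDegree_flatSum : ∀ M : Matroid α, M.Loopless → (flatSum P M).natDegree = M.natRank
  palindromic : ∀ M : Matroid α, M.Loopless → (flatSum P M).reverse = flatSum P M

lemma ncard_contract_lt [Finite α] {M : Matroid α} {F : Set α} (hF : M.IsFlat F)
    (h0 : F.Nonempty) : (M ／ F).E.ncard < M.E.ncard := by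
  refine Set.ncard_lt_ncard ?_ (Set.toFinite _)
  rw [contract_ground, Set.sdiff_ssubset_left_iff]
  obtain ⟨x, hx⟩ := h0
  exact ⟨x, hF.subset_ground hx, hx⟩

/-- The Kazhdan–Lusztig polynomial of a (loopless) matroid on a finite type. If `r` is the rank and
`R` is the part of the `Z`-polynomial that comes from the nonempty flats, then the conditions
`deg P < r / 2` and `P + R` palindromic of degree `r` say precisely that the coefficients of `P`
are `R.coeff (r - i) - R.coeff i` for `2 * i < r`. See `isKLAssignment_klPoly` and
`IsKLAssignment.eq_klPoly`. -/
noncomputable def klPoly [Finite α] (M : Matroid α) : ℤ[X] :=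
  if M.natRank = 0 then 1 else
    ∑ i ∈ Finset.range M.natRank with 2 * i < M.natRank,
      C ((∑ᶠ F : {F : Set α // M.IsFlat F ∧ F.Nonempty},
            X ^ M.natRk F.1 * klPoly (M ／ F.1)).coeff (M.natRank - i) -
          (∑ᶠ F : {F : Set α // M.IsFlat F ∧ F.Nonempty},
            X ^ M.natRk F.1 * klPoly (M ／ F.1)).coeff i) * X ^ i
termination_by M.E.ncard
decreasing_by
  all_goals exact ncard_contract_lt F.2.1 F.2.2

/-- The `Z`-polynomial of a (loopless) matroid on a finite type. -/
noncomputable def zPoly [Finite α] (M : Matroid α) : ℤ[X] := flatSum klPoly M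

lemma loopless_contract {M : Matroid α} {F : Set α} (hF : M.IsFlat F) : (M ／ F).Loopless := by
  rw [loopless_iff, contract_loops_eq, hF.closure, Set.sdiff_self]

lemma natRk_add_natRank_contract [Finite α] {M : Matroid α} {F : Set α} (hF : M.IsFlat F) :
    M.natRk F + (M ／ F).natRank = M.natRank := by
  obtain ⟨I, hI⟩ := M.exists_isBasis F hF.subset_ground
  obtain ⟨B, hB, hIB⟩ := hI.indep.exists_isBase_superset
  have hBF : B ∩ F = I :=
    (hI.eq_of_subset_indep (hB.indep.inter_right F) (Set.subset_inter hIB hI.subset)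
      Set.inter_subset_right).symm
  have h1 : (M ／ F).IsBase (B \ F) := by
    have := hB.isBasis_ground.contract_isBasis hI
      (by rw [← hBF, Set.sdiff_union_inter]; exact hB.indep)
    rwa [← contract_ground, isBasis_ground_iff] at this
  rw [natRk, natRank, natRank, ← hI.encard_eq_eRk, ← h1.encard_eq_eRank, ← hB.encard_eq_eRank,
    ← hBF]
  change (B ∩ F).ncard + (B \ F).ncard = B.ncard
  exact Set.ncard_inter_add_ncard_sdiff_eq_ncard B F (Set.toFinite _)

lemma natRank_eq_zero_iff [Finite α] {M : Matroid α} (hM : M.Loopless) :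
    M.natRank = 0 ↔ M.E = ∅ := by
  constructor
  · intro h
    have h1 : M.eRank = 0 := by
      rcases (ENat.toNat_eq_zero).1 h with h | h
      · exact h
      · exact absurd h ((eRank_ne_top_iff M).2 inferInstance)
    rw [← eRk_ground, eRk_eq_zero_iff, hM.loops_eq_empty] at h1
    exact Set.subset_empty_iff.1 h1
  · intro h
    rw [natRank, ← eRk_ground, h, eRk_empty]; rfl

lemma isFlat_empty {M : Matroid α} (hM : M.Loopless) : M.IsFlat ∅ := by
  rw [isFlat_iff_closure_eq]
  exact M.loops_eq_empty

lemma flatSum_eq [Finite α] (P : Matroid α → ℤ[X]) {M : Matroid α} (hM : M.Loopless) :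
    flatSum P M = P M + ∑ᶠ F : {F : Set α // M.IsFlat F ∧ F.Nonempty},
      X ^ M.natRk F.1 * P (M ／ F.1) := by
  classical
  have h1 : flatSum P M = ∑ᶠ (F : Set α) (_ : F ∈ {F | M.IsFlat F}),
      X ^ M.natRk F * P (M ／ F) :=
    finsum_set_coe_eq_finsum_mem (f := fun F ↦ X ^ M.natRk F * P (M ／ F)) {F | M.IsFlat F}
  have h2 : ∑ᶠ F : {F : Set α // M.IsFlat F ∧ F.Nonempty}, X ^ M.natRk F.1 * P (M ／ F.1) =
      ∑ᶠ (F : Set α) (_ : F ∈ {F | M.IsFlat F ∧ F.Nonempty}), X ^ M.natRk F * P (M ／ F) :=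
    finsum_set_coe_eq_finsum_mem (f := fun F ↦ X ^ M.natRk F * P (M ／ F))
      {F | M.IsFlat F ∧ F.Nonempty}
  have h3 : {F | M.IsFlat F} = insert ∅ {F | M.IsFlat F ∧ F.Nonempty} := by
    ext F
    rcases F.eq_empty_or_nonempty with rfl | h
    · simp [isFlat_empty hM]
    · simp [h, h.ne_empty]
  rw [h1, h2, h3, finsum_mem_insert _ (by simp) (Set.toFinite _)]
  simp [natRk]

lemma klPoly_eq [Finite α] (M : Matroid α) (h : M.natRank ≠ 0) :
    M.klPoly = ∑ i ∈ Finset.range M.natRank with 2 * i < M.natRank,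
      C ((∑ᶠ F : {F : Set α // M.IsFlat F ∧ F.Nonempty},
            X ^ M.natRk F.1 * klPoly (M ／ F.1)).coeff (M.natRank - i) -
          (∑ᶠ F : {F : Set α // M.IsFlat F ∧ F.Nonempty},
            X ^ M.natRk F.1 * klPoly (M ／ F.1)).coeff i) * X ^ i := by
  rw [klPoly, if_neg h]

lemma coeff_klPoly [Finite α] (M : Matroid α) (h : M.natRank ≠ 0) (i : ℕ) :
    M.klPoly.coeff i = if 2 * i < M.natRank then
        (∑ᶠ F : {F : Set α // M.IsFlat F ∧ F.Nonempty},
            X ^ M.natRk F.1 * klPoly (M ／ F.1)).coeff (M.natRank - i) -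
          (∑ᶠ F : {F : Set α // M.IsFlat F ∧ F.Nonempty},
            X ^ M.natRk F.1 * klPoly (M ／ F.1)).coeff i else 0 := by
  rw [klPoly_eq M h, finsetSum_coeff]
  simp only [coeff_C_mul_X_pow]
  rw [Finset.sum_ite_eq]
  refine if_congr ?_ rfl rfl
  simp only [Finset.mem_filter, Finset.mem_range]
  omega

lemma klPoly_of_natRank_eq_zero [Finite α] (M : Matroid α) (h : M.natRank = 0) :
    M.klPoly = 1 := by
  rw [klPoly, if_pos h]

lemma natDegree_klPoly [Finite α] (M : Matroid α) (h : 0 < M.natRank) :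
    2 * M.klPoly.natDegree < M.natRank := by
  by_cases h0 : M.klPoly = 0
  · simpa [h0] using h
  by_contra hc
  have := coeff_klPoly M h.ne' M.klPoly.natDegree
  rw [if_neg hc, coeff_natDegree, leadingCoeff_eq_zero] at this
  exact h0 this

lemma coeff_term [Finite α] {P : Matroid α → ℤ[X]}
    (h0 : ∀ M : Matroid α, M.Loopless → M.natRank = 0 → P M = 1)
    (h1 : ∀ M : Matroid α, M.Loopless → 0 < M.natRank → 2 * (P M).natDegree < M.natRank)
    {M : Matroid α} {F : Set α} (hF : M.IsFlat F) (i : ℕ) (hi : M.natRank ≤ i) :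
    (X ^ M.natRk F * P (M ／ F)).coeff i = if F = M.E ∧ i = M.natRank then 1 else 0 := by
  have hl := loopless_contract hF
  have hr := natRk_add_natRank_contract hF
  have hE : (M ／ F).natRank = 0 ↔ F = M.E := by
    rw [natRank_eq_zero_iff hl, contract_ground, Set.sdiff_eq_empty]
    exact ⟨fun h ↦ hF.subset_ground.antisymm h, fun h ↦ h ▸ subset_rfl⟩
  rw [coeff_X_pow_mul']
  by_cases h : F = M.E
  · rw [h0 _ hl (hE.2 h), coeff_one]
    have := hE.2 h
    simp only [h, true_and]
    subst h
    split_ifs <;> omega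
  · have h2 := h1 _ hl (Nat.pos_of_ne_zero (fun h' ↦ h (hE.1 h')))
    rw [coeff_eq_zero_of_natDegree_lt (by omega)]
    simp [h]

lemma coeff_flatSum [Finite α] {P : Matroid α → ℤ[X]}
    (h0 : ∀ M : Matroid α, M.Loopless → M.natRank = 0 → P M = 1)
    (h1 : ∀ M : Matroid α, M.Loopless → 0 < M.natRank → 2 * (P M).natDegree < M.natRank)
    (M : Matroid α) (i : ℕ) (hi : M.natRank ≤ i) :
    (flatSum P M).coeff i = if i = M.natRank then 1 else 0 := by
  classical
  have := Fintype.ofFinite {F : Set α // M.IsFlat F}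
  rw [flatSum, finsum_eq_sum_of_fintype, finsetSum_coeff,
    Finset.sum_congr rfl fun F _ ↦ coeff_term h0 h1 F.2 i hi]
  rw [Finset.sum_eq_single (⟨M.E, M.ground_isFlat⟩ : {F : Set α // M.IsFlat F})]
  · simp
  · intro F _ hF
    rw [if_neg]
    exact fun h ↦ hF (Subtype.ext h.1)
  · simp

/-- The polynomials `klPoly` satisfy the defining conditions. -/
theorem isKLAssignment_klPoly [Finite α] : IsKLAssignment (klPoly (α := α)) := by
  have h0 : ∀ M : Matroid α, M.Loopless → M.natRank = 0 → M.klPoly = 1 :=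
    fun M _ h ↦ klPoly_of_natRank_eq_zero M h
  have h1 : ∀ M : Matroid α, M.Loopless → 0 < M.natRank →
    2 * M.klPoly.natDegree < M.natRank := fun M _ h ↦ natDegree_klPoly M h
  have h2 : ∀ M : Matroid α, M.Loopless → (flatSum klPoly M).natDegree = M.natRank := by
    intro M _
    refine natDegree_eq_of_le_of_coeff_ne_zero ?_ ?_
    · rw [natDegree_le_iff_coeff_eq_zero]
      intro i hi
      rw [coeff_flatSum h0 h1 M i hi.le, if_neg hi.ne']
    · rw [coeff_flatSum h0 h1 M _ le_rfl, if_pos rfl]; exact one_ne_zero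
  refine ⟨h0, h1, h2, fun M hM ↦ ?_⟩
  ext i
  rw [coeff_reverse, h2 M hM]
  rcases lt_or_ge M.natRank i with hi | hi
  · rw [revAt_eq_self_of_lt hi]
  rw [revAt_le hi]
  rcases Nat.eq_zero_or_pos M.natRank with hr | hr
  · congr 1; omega
  have key : ∀ j, 2 * j < M.natRank →
      (flatSum klPoly M).coeff (M.natRank - j) = (flatSum klPoly M).coeff j := by
    intro j hj
    rw [flatSum_eq _ hM, coeff_add, coeff_add, coeff_klPoly M hr.ne', coeff_klPoly M hr.ne',
      if_neg (by omega), if_pos hj]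
    ring
  rcases lt_trichotomy (2 * i) M.natRank with h | h | h
  · exact key i h
  · congr 1; omega
  · have := key (M.natRank - i) (by omega)
    rw [← this]; congr 1; omega

/-- The defining conditions determine the Kazhdan–Lusztig polynomials. -/
theorem IsKLAssignment.eq_klPoly [Finite α] {P : Matroid α → ℤ[X]} (hP : IsKLAssignment P)
    (M : Matroid α) (hM : M.Loopless) : P M = M.klPoly := by
  induction h : M.E.ncard using Nat.strong_induction_on generalizing M with
  | _ k ih =>
  subst h
  rcases Nat.eq_zero_or_pos M.natRank with hr | hr
  · rw [hP.rank_zero M hM hr, klPoly_of_natRank_eq_zero M hr]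
  have hR : ∑ᶠ F : {F : Set α // M.IsFlat F ∧ F.Nonempty}, X ^ M.natRk F.1 * P (M ／ F.1) =
      ∑ᶠ F : {F : Set α // M.IsFlat F ∧ F.Nonempty}, X ^ M.natRk F.1 * klPoly (M ／ F.1) := by
    refine finsum_congr fun F ↦ ?_
    rw [ih _ (ncard_contract_lt F.2.1 F.2.2) _ (loopless_contract F.2.1) rfl]
  ext i
  rw [coeff_klPoly M hr.ne']
  have hd := hP.degree_lt M hM hr
  split_ifs with hi
  · have h1 := congrArg (fun p ↦ p.coeff i) (hP.palindromic M hM)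
    simp only [coeff_reverse, hP.natDegree_flatSum M hM] at h1
    rw [revAt_le (by omega), flatSum_eq _ hM, hR, coeff_add, coeff_add,
      coeff_eq_zero_of_natDegree_lt (p := P M) (n := M.natRank - i) (by omega)] at h1
    linarith
  · exact coeff_eq_zero_of_natDegree_lt (by omega)

end Matroid

/-! ## Dowling geometries -/

/-- A partial `G`-partition of `[n]`: a subset of `[n]`, a `G`-valued function on it, and a partition
of it into unordered nonempty blocks (the classes of an equivalence relation). -/
structure PartialGPartition (n : ℕ) (G : Type*) where
  /-- The underlying subset of `[n]`. -/
  carrier : Set (Fin n)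
  /-- The `G`-valued function on the subset. -/
  label : carrier → G
  /-- The partition of the subset, given by the relation of lying in the same block. -/
  blocks : Setoid carrier

namespace PartialGPartition

variable {n : ℕ} {G : Type*}

/-- `i` and `j` lie in the subset and in the same block. -/
def Rel (p : PartialGPartition n G) (i j : Fin n) : Prop :=
  ∃ (hi : i ∈ p.carrier) (hj : j ∈ p.carrier), p.blocks ⟨i, hi⟩ ⟨j, hj⟩

/-- Two partial `G`-partitions are equivalent if they have the same subset and the same blocks, and
on each block the labels differ by left multiplication by an element of `G`. -/
def Equivalent [Group G] (p p' : PartialGPartition n G) : Prop :=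
  p.carrier = p'.carrier ∧ (∀ i j, p.Rel i j ↔ p'.Rel i j) ∧
    ∀ i, ∃ g : G, ∀ j (h : j ∈ p.carrier) (h' : j ∈ p'.carrier), p.Rel i j →
      p.label ⟨j, h⟩ = g * p'.label ⟨j, h'⟩

/-- `p'` is obtained from `p` by deleting a block, the block of `i`. -/
def IsDeletion (p p' : PartialGPartition n G) : Prop :=
  ∃ i ∈ p.carrier, p'.carrier = {k | k ∈ p.carrier ∧ ¬ p.Rel i k} ∧
    (∀ k l, p'.Rel k l ↔ p.Rel k l ∧ ¬ p.Rel i k) ∧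
    ∀ k (h : k ∈ p.carrier) (h' : k ∈ p'.carrier), p'.label ⟨k, h'⟩ = p.label ⟨k, h⟩

/-- `p'` is obtained from `p` by merging two different blocks, those of `i` and `j`. -/
def IsMerging (p p' : PartialGPartition n G) : Prop :=
  ∃ i ∈ p.carrier, ∃ j ∈ p.carrier, ¬ p.Rel i j ∧ p'.carrier = p.carrier ∧
    (∀ k l, p'.Rel k l ↔ p.Rel k l ∨ (p.Rel i k ∨ p.Rel j k) ∧ (p.Rel i l ∨ p.Rel j l)) ∧
    ∀ k (h : k ∈ p.carrier) (h' : k ∈ p'.carrier), p'.label ⟨k, h'⟩ = p.label ⟨k, h⟩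

/-- `p` refines `p'` if `p'` is obtained from `p`, up to equivalence, by a sequence of operations
consisting of merging blocks and deleting blocks. -/
def Refines [Group G] : PartialGPartition n G → PartialGPartition n G → Prop :=
  Relation.ReflTransGen fun p p' ↦ p.Equivalent p' ∨ p.IsMerging p' ∨ p.IsDeletion p'

/-- The number of blocks. -/
noncomputable def numBlocks (p : PartialGPartition n G) : ℕ := Nat.card (Quotient p.blocks)

/-! ### A description of the refinement order -/

variable {p p' p'' : PartialGPartition n G} {i j k l : Fin n} {g h : G}

lemma Rel.left (h : p.Rel i j) : i ∈ p.carrier := h.1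
lemma Rel.right (h : p.Rel i j) : j ∈ p.carrier := h.2.1
lemma rel_refl (h : i ∈ p.carrier) : p.Rel i i := ⟨h, h, p.blocks.refl _⟩
lemma Rel.symm (h : p.Rel i j) : p.Rel j i := ⟨h.2.1, h.1, p.blocks.symm h.2.2⟩
lemma Rel.trans (h : p.Rel i j) (h' : p.Rel j k) : p.Rel i k :=
  ⟨h.1, h'.2.1, p.blocks.trans h.2.2 h'.2.2⟩

/-- Delete the block of `i`. -/
def del (p : PartialGPartition n G) (i : Fin n) : PartialGPartition n G where
  carrier := {k | k ∈ p.carrier ∧ ¬ p.Rel i k}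
  label k := p.label ⟨k.1, k.2.1⟩
  blocks := p.blocks.comap fun k ↦ ⟨k.1, k.2.1⟩

lemma numBlocks_le_del (hi : i ∈ p.carrier) : p.numBlocks ≤ (p.del i).numBlocks + 1 := by
  classical
  unfold numBlocks
  rw [← Finite.card_option]
  refine Nat.card_le_card_of_surjective (fun c : Option (Quotient (p.del i).blocks) ↦
    c.elim (⟦⟨i, hi⟩⟧ : Quotient p.blocks) (Quotient.lift (fun k ↦ ⟦⟨k.1, k.2.1⟩⟧)
      fun a b hab ↦ Quotient.sound hab)) ?_
  intro c
  induction c using Quotient.inductionOn with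
  | h k =>
    by_cases hk : p.Rel i k
    · exact ⟨none, Quotient.sound hk.2.2⟩
    · exact ⟨some ⟦⟨k.1, k.2, hk⟩⟧, rfl⟩

lemma del_rel : (p.del i).Rel k l ↔ p.Rel k l ∧ ¬ p.Rel i k :=
  ⟨fun ⟨h1, h2, h3⟩ ↦ ⟨⟨h1.1, h2.1, h3⟩, h1.2⟩,
    fun ⟨h, h'⟩ ↦ ⟨⟨h.left, h'⟩, ⟨h.right, fun h2 ↦ h' (h2.trans h.symm)⟩, h.2.2⟩⟩

/-- Merge the blocks of `i` and `j`. -/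
def merge (p : PartialGPartition n G) (i j : Fin n) : PartialGPartition n G where
  carrier := p.carrier
  label := p.label
  blocks :=
    { r := fun k l ↦ p.Rel k l ∨ (p.Rel i k ∨ p.Rel j k) ∧ (p.Rel i l ∨ p.Rel j l)
      iseqv := by
        refine ⟨fun k ↦ .inl (rel_refl k.2), ?_, ?_⟩
        · rintro k l (h | ⟨h, h'⟩)
          · exact .inl h.symm
          · exact .inr ⟨h', h⟩
        · rintro k l m (h | ⟨h, h'⟩) (h2 | ⟨h2, h3⟩)
          · exact .inl (h.trans h2)
          · exact .inr ⟨h2.imp (·.trans h.symm) (·.trans h.symm), h3⟩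
          · exact .inr ⟨h, h'.imp (·.trans h2) (·.trans h2)⟩
          · exact .inr ⟨h, h3⟩ }

lemma merge_rel : (p.merge i j).Rel k l ↔
    p.Rel k l ∨ (p.Rel i k ∨ p.Rel j k) ∧ (p.Rel i l ∨ p.Rel j l) := by
  constructor
  · rintro ⟨_, _, h⟩
    exact h
  · intro h
    refine ⟨?_, ?_, h⟩
    · rcases h with h | ⟨h | h, _⟩
      exacts [h.left, h.right, h.right]
    · rcases h with h | ⟨_, h | h⟩
      exacts [h.right, h.right, h.right]

lemma isDeletion_del (hi : i ∈ p.carrier) : p.IsDeletion (p.del i) :=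
  ⟨i, hi, rfl, fun _ _ ↦ del_rel, fun _ _ _ ↦ rfl⟩

lemma isMerging_merge (hi : i ∈ p.carrier) (hj : j ∈ p.carrier) (hij : ¬ p.Rel i j) :
    p.IsMerging (p.merge i j) :=
  ⟨i, hi, j, hj, hij, rfl, fun _ _ ↦ merge_rel, fun _ _ _ ↦ rfl⟩

section
variable [Group G]

/-- Either both `i` and `j` are outside of the subset, or they are in the same block, and `g` is the
quotient of their labels. -/
def Edge (p : PartialGPartition n G) (i j : Fin n) (g : G) : Prop :=
  (i ∉ p.carrier ∧ j ∉ p.carrier) ∨ ∃ (hi : i ∈ p.carrier) (hj : j ∈ p.carrier),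
    p.Rel i j ∧ p.label ⟨i, hi⟩ * g = p.label ⟨j, hj⟩

/-- A description of the refinement order, see `refines_iff`. -/
def Le (p p' : PartialGPartition n G) : Prop :=
  (∀ i, i ∉ p.carrier → i ∉ p'.carrier) ∧ ∀ i j g, p.Edge i j g → p'.Edge i j g

lemma edge_of_rel (h : p.Rel i j) :
    p.Edge i j ((p.label ⟨i, h.left⟩)⁻¹ * p.label ⟨j, h.right⟩) :=
  .inr ⟨h.left, h.right, h, by simp⟩

lemma edge_refl (i : Fin n) : p.Edge i i 1 := by
  by_cases h : i ∈ p.carrier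
  · exact .inr ⟨h, h, rel_refl h, mul_one _⟩
  · exact .inl ⟨h, h⟩

lemma Edge.symm (h : p.Edge i j g) : p.Edge j i g⁻¹ := by
  rcases h with ⟨hi, hj⟩ | ⟨hi, hj, hr, he⟩
  · exact .inl ⟨hj, hi⟩
  · exact .inr ⟨hj, hi, hr.symm, by rw [← he]; simp⟩

lemma Edge.trans (h1 : p.Edge i j g) (h2 : p.Edge j k h) : p.Edge i k (g * h) := by
  rcases h1 with ⟨hi, hj⟩ | ⟨hi, hj, hr, he⟩ <;> rcases h2 with ⟨hj', hk⟩ | ⟨hj', hk, hr', he'⟩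
  · exact .inl ⟨hi, hk⟩
  · exact absurd hj' hj
  · exact absurd hj hj'
  · exact .inr ⟨hi, hk, hr.trans hr', by rw [← mul_assoc, he, he']⟩

lemma Edge.notMem (h : p.Edge i j g) (hi : i ∉ p.carrier) : j ∉ p.carrier := by
  rcases h with ⟨_, hj⟩ | ⟨hi', _⟩
  · exact hj
  · exact absurd hi' hi

lemma Edge.mem (h : p.Edge i j g) (hi : i ∈ p.carrier) : j ∈ p.carrier := by
  by_contra hj
  exact h.symm.notMem hj hi

lemma Edge.rel (h : p.Edge i j g) (hi : i ∈ p.carrier) : p.Rel i j := by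
  rcases h with ⟨hi', _⟩ | ⟨_, _, h, _⟩
  · exact absurd hi hi'
  · exact h

lemma Edge.label (h : p.Edge i j g) (hi : i ∈ p.carrier) (hj : j ∈ p.carrier) :
    p.label ⟨i, hi⟩ * g = p.label ⟨j, hj⟩ := by
  rcases h with ⟨hi', _⟩ | ⟨_, _, _, h⟩
  · exact absurd hi hi'
  · exact h

lemma Edge.unique (h1 : p.Edge i j g) (h2 : p.Edge i j h) (hi : i ∈ p.carrier) : g = h :=
  mul_left_cancel ((h1.label hi (h1.mem hi)).trans (h2.label hi (h1.mem hi)).symm)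

lemma edge_of_notMem (hi : i ∉ p.carrier) (hj : j ∉ p.carrier) : p.Edge i j g := .inl ⟨hi, hj⟩

lemma Le.refl (p : PartialGPartition n G) : p.Le p := ⟨fun _ h ↦ h, fun _ _ _ h ↦ h⟩

lemma Le.trans (h : p.Le p') (h' : p'.Le p'') : p.Le p'' :=
  ⟨fun i hi ↦ h'.1 i (h.1 i hi), fun i j g hg ↦ h'.2 i j g (h.2 i j g hg)⟩

lemma Le.mem (h : p.Le p') (hi : i ∈ p'.carrier) : i ∈ p.carrier := by
  by_contra h'
  exact h.1 i h' hi

lemma Equivalent.le (h : p.Equivalent p') : p.Le p' := by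
  obtain ⟨h1, h2, h3⟩ := h
  refine ⟨fun i ↦ by simp [h1], ?_⟩
  rintro i j g (⟨hi, hj⟩ | ⟨hi, hj, hr, he⟩)
  · exact .inl ⟨h1 ▸ hi, h1 ▸ hj⟩
  · obtain ⟨c, hc⟩ := h3 i
    refine .inr ⟨h1 ▸ hi, h1 ▸ hj, (h2 i j).1 hr, ?_⟩
    rw [hc i hi (h1 ▸ hi) (rel_refl hi), hc j hj (h1 ▸ hj) hr, mul_assoc] at he
    exact mul_left_cancel he

lemma equivalent_iff : p.Equivalent p' ↔ p.Le p' ∧ p'.Le p := by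
  constructor
  · intro h
    refine ⟨h.le, Equivalent.le ⟨h.1.symm, fun i j ↦ (h.2.1 i j).symm, fun i ↦ ?_⟩⟩
    obtain ⟨c, hc⟩ := h.2.2 i
    refine ⟨c⁻¹, fun j hj hj' hr ↦ ?_⟩
    rw [hc j hj' hj ((h.2.1 i j).2 hr)]
    simp
  · rintro ⟨h1, h2⟩
    have hS : p.carrier = p'.carrier := by
      ext i; exact ⟨fun h ↦ h2.mem h, fun h ↦ h1.mem h⟩
    refine ⟨hS, fun i j ↦ ⟨fun h ↦ (h1.2 i j _ (edge_of_rel h)).rel (h2.mem h.left),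
      fun h ↦ (h2.2 i j _ (edge_of_rel h)).rel (h1.mem h.left)⟩, fun i ↦ ?_⟩
    by_cases hi : i ∈ p.carrier
    · refine ⟨p.label ⟨i, hi⟩ * (p'.label ⟨i, h2.mem hi⟩)⁻¹, fun j hj hj' hr ↦ ?_⟩
      have := (h1.2 i j _ (edge_of_rel hr)).label (h2.mem hi) hj'
      rw [← this]
      simp [mul_assoc]
    · exact ⟨1, fun j hj hj' hr ↦ absurd hr.left hi⟩

lemma IsDeletion.le (h : p.IsDeletion p') : p.Le p' := by
  obtain ⟨a, ha, h1, h2, h3⟩ := h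
  refine ⟨fun i hi ↦ by simp [h1, hi], ?_⟩
  rintro i j g (⟨hi, hj⟩ | ⟨hi, hj, hr, he⟩)
  · exact .inl ⟨by simp [h1, hi], by simp [h1, hj]⟩
  · by_cases hai : p.Rel a i
    · exact .inl ⟨by simp [h1, hai], by simp [h1, hai.trans hr]⟩
    · have hi' : i ∈ p'.carrier := by simp [h1, hi, hai]
      have hj' : j ∈ p'.carrier := by
        rw [h1]
        exact ⟨hj, fun h ↦ hai (h.trans hr.symm)⟩
      exact .inr ⟨hi', hj', (h2 i j).2 ⟨hr, hai⟩, by rw [h3 i hi hi', h3 j hj hj', he]⟩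

lemma IsMerging.le (h : p.IsMerging p') : p.Le p' := by
  obtain ⟨a, ha, b, hb, hab, h1, h2, h3⟩ := h
  refine ⟨fun i hi ↦ by simp [h1, hi], ?_⟩
  rintro i j g (⟨hi, hj⟩ | ⟨hi, hj, hr, he⟩)
  · exact .inl ⟨by simp [h1, hi], by simp [h1, hj]⟩
  · exact .inr ⟨h1 ▸ hi, h1 ▸ hj, (h2 i j).2 (.inl hr),
      by rw [h3 i hi (h1 ▸ hi), h3 j hj (h1 ▸ hj), he]⟩

lemma del_le_iff (hi : i ∈ p.carrier) : (p.del i).Le p' ↔ p.Le p' ∧ i ∉ p'.carrier := by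
  constructor
  · intro h
    exact ⟨(isDeletion_del hi).le.trans h, h.1 i fun h' ↦ h'.2 (rel_refl hi)⟩
  · rintro ⟨h, hi'⟩
    have key : ∀ k, k ∉ (p.del i).carrier → k ∉ p'.carrier := by
      intro k hk
      by_cases hk' : k ∈ p.carrier
      · have hr : p.Rel i k := by
          by_contra hr
          exact hk ⟨hk', hr⟩
        exact (h.2 _ _ _ (edge_of_rel hr)).notMem hi'
      · exact h.1 k hk'
    refine ⟨key, ?_⟩
    rintro k l g (⟨hk, hl⟩ | ⟨hk, hl, hr, he⟩)
    · exact .inl ⟨key k hk, key l hl⟩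
    · exact h.2 _ _ _ (.inr ⟨hk.1, hl.1, (del_rel.1 hr).1, he⟩)

open Classical in
/-- Relabel the block of `j` so that there is an edge with label `g` from `i` to `j`. -/
noncomputable def relabel (p : PartialGPartition n G) (i j : Fin n) (hi : i ∈ p.carrier)
    (hj : j ∈ p.carrier) (g : G) : PartialGPartition n G where
  carrier := p.carrier
  label k := if p.Rel j k then p.label ⟨i, hi⟩ * g * (p.label ⟨j, hj⟩)⁻¹ * p.label k
    else p.label k
  blocks := p.blocks

lemma equivalent_relabel (hi : i ∈ p.carrier) (hj : j ∈ p.carrier) :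
    p.Equivalent (p.relabel i j hi hj g) := by
  refine ⟨rfl, fun _ _ ↦ Iff.rfl, fun k ↦ ?_⟩
  by_cases hk : p.Rel j k
  · refine ⟨(p.label ⟨i, hi⟩ * g * (p.label ⟨j, hj⟩)⁻¹)⁻¹, fun l h h' hl ↦ ?_⟩
    simp [relabel, hk.trans hl, mul_assoc]
  · refine ⟨1, fun l h h' hl ↦ ?_⟩
    have : ¬ p.Rel j l := fun hh ↦ hk (hh.trans hl.symm)
    simp [relabel, this]

/-- Merge the blocks of `i` and `j` so that there is an edge with label `g` from `i` to `j`. -/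
noncomputable def join (p : PartialGPartition n G) (i j : Fin n) (hi : i ∈ p.carrier)
    (hj : j ∈ p.carrier) (g : G) : PartialGPartition n G := (p.relabel i j hi hj g).merge i j

lemma join_edge (hi : i ∈ p.carrier) (hj : j ∈ p.carrier) (hij : ¬ p.Rel i j) :
    (p.join i j hi hj g).Edge i j g := by
  refine .inr ⟨hi, hj, merge_rel.2 (.inr ⟨.inl (rel_refl hi), .inr (rel_refl hj)⟩), ?_⟩
  have hji : ¬ p.Rel j i := fun h ↦ hij h.symm
  simp [join, merge, relabel, rel_refl hj, hji]

lemma le_join (hi : i ∈ p.carrier) (hj : j ∈ p.carrier) (hij : ¬ p.Rel i j) :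
    p.Le (p.join i j hi hj g) :=
  (equivalent_relabel hi hj).le.trans (isMerging_merge (p := p.relabel i j hi hj g) hi hj hij).le


lemma merge_le (h : p.Le p') (hi : i ∈ p.carrier) (hj : j ∈ p.carrier)
    (he : p'.Edge i j ((p.label ⟨i, hi⟩)⁻¹ * p.label ⟨j, hj⟩)) : (p.merge i j).Le p' := by
  have key : ∀ k (hk : k ∈ p.carrier), p.Rel i k ∨ p.Rel j k →
      p'.Edge i k ((p.label ⟨i, hi⟩)⁻¹ * p.label ⟨k, hk⟩) := by
    rintro k hk (h' | h')
    · exact h.2 _ _ _ (edge_of_rel h')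
    · have := he.trans (h.2 _ _ _ (edge_of_rel h'))
      simpa [mul_assoc] using this
  refine ⟨h.1, ?_⟩
  rintro k l c (⟨hk, hl⟩ | ⟨hk, hl, hr, hc⟩)
  · exact .inl ⟨h.1 k hk, h.1 l hl⟩
  · rcases merge_rel.1 hr with hr | ⟨h1, h2⟩
    · exact h.2 _ _ _ (.inr ⟨hk, hl, hr, hc⟩)
    · have h3 := (key k hk h1).symm.trans (key l hl h2)
      have h4 : p.label ⟨k, hk⟩ * c = p.label ⟨l, hl⟩ := hc
      rw [← h4] at h3
      simpa [mul_assoc] using h3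

lemma join_le_iff (hi : i ∈ p.carrier) (hj : j ∈ p.carrier) (hij : ¬ p.Rel i j) :
    (p.join i j hi hj g).Le p' ↔ p.Le p' ∧ p'.Edge i j g := by
  constructor
  · intro h
    exact ⟨(le_join hi hj hij).trans h, h.2 _ _ _ (join_edge hi hj hij)⟩
  · rintro ⟨h, he⟩
    refine merge_le (p := p.relabel i j hi hj g) (hi := hi) (hj := hj)
      ((equivalent_iff.1 (equivalent_relabel hi hj)).2.trans h) ?_
    have hji : ¬ p.Rel j i := fun h ↦ hij h.symm
    simpa [relabel, rel_refl hj, hji] using he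

lemma numBlocks_le_join (hi : i ∈ p.carrier) (hj : j ∈ p.carrier) :
    p.numBlocks ≤ (p.join i j hi hj g).numBlocks + 1 := by
  classical
  unfold numBlocks
  rw [← Finite.card_option]
  refine Nat.card_le_card_of_surjective (fun c : Option (Quotient (p.join i j hi hj g).blocks) ↦
    c.elim (⟦⟨j, hj⟩⟧ : Quotient p.blocks) (Quotient.lift
      (fun k ↦ if p.Rel j k then ⟦⟨i, hi⟩⟧ else ⟦k⟧) ?_)) ?_
  · rintro a b (hab | ⟨ha, hb⟩)
    · have hab : p.Rel a b := hab
      by_cases h : p.Rel j a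
      · rw [if_pos h, if_pos (h.trans hab)]
      · rw [if_neg h, if_neg fun h' ↦ h (h'.trans hab.symm)]
        exact Quotient.sound hab.2.2
    · have key : ∀ a : p.carrier, p.Rel i a ∨ p.Rel j a →
          (if p.Rel j a then ⟦⟨i, hi⟩⟧ else ⟦a⟧ : Quotient p.blocks) = ⟦⟨i, hi⟩⟧ := by
        rintro a (ha | ha)
        · split_ifs
          · rfl
          · exact Quotient.sound ha.symm.2.2
        · rw [if_pos ha]
      exact (key a ha).trans (key b hb).symm
  · intro c
    induction c using Quotient.inductionOn with
    | h k =>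
      by_cases hk : p.Rel j k
      · exact ⟨none, Quotient.sound hk.2.2⟩
      · exact ⟨some ⟦k⟧, if_neg hk⟩

/-- Choose an element of each block of `p'` and take its block in `p`. -/
noncomputable def blockMap (h : p.Le p') (c : Quotient p'.blocks) : Quotient p.blocks :=
  ⟦⟨c.out.1, h.mem c.out.2⟩⟧

lemma blockMap_injective (h : p.Le p') : Function.Injective (blockMap h) := by
  intro c d hcd
  have hr : p.Rel c.out.1 d.out.1 := ⟨_, _, Quotient.exact hcd⟩
  have := (h.2 _ _ _ (edge_of_rel hr)).rel c.out.2
  rw [← c.out_eq, ← d.out_eq]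
  exact Quotient.sound this.2.2

lemma Le.numBlocks_le (h : p.Le p') : p'.numBlocks ≤ p.numBlocks :=
  Nat.card_le_card_of_injective _ (blockMap_injective h)

lemma Le.le_of_numBlocks_le (h : p.Le p') (hc : p.numBlocks ≤ p'.numBlocks) : p'.Le p := by
  have hs : Function.Surjective (blockMap h) :=
    ((Nat.bijective_iff_injective_and_card _).2 ⟨blockMap_injective h,
      h.numBlocks_le.antisymm hc⟩).2
  have key : ∀ i (hi : i ∈ p.carrier), ∃ c : Quotient p'.blocks, p.Rel c.out.1 i := by
    intro i hi
    obtain ⟨c, hc⟩ := hs ⟦⟨i, hi⟩⟧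
    exact ⟨c, h.mem c.out.2, hi, Quotient.exact hc⟩
  have hmem : ∀ i, i ∉ p'.carrier → i ∉ p.carrier := by
    intro i hi hi'
    obtain ⟨c, hc⟩ := key i hi'
    exact hi ((h.2 _ _ _ (edge_of_rel hc)).mem c.out.2)
  refine ⟨hmem, ?_⟩
  rintro i j g (⟨hi, hj⟩ | ⟨hi, hj, hr, he⟩)
  · exact .inl ⟨hmem i hi, hmem j hj⟩
  · obtain ⟨c, hc⟩ := key i (h.mem hi)
    obtain ⟨d, hd⟩ := key j (h.mem hj)
    have h1 := (h.2 _ _ _ (edge_of_rel hc)).rel c.out.2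
    have h2 := (h.2 _ _ _ (edge_of_rel hd)).rel d.out.2
    have hcd : c = d := by
      rw [← c.out_eq, ← d.out_eq]
      exact Quotient.sound ((h1.trans hr).trans h2.symm).2.2
    subst hcd
    have h3 : p.Rel i j := hc.symm.trans hd
    have h4 := edge_of_rel h3
    rwa [← Edge.unique (.inr ⟨hi, hj, hr, he⟩) (h.2 _ _ _ h4) hi] at h4

lemma Refines.le (h : p.Refines p') : p.Le p' := by
  induction h with
  | refl => exact .refl _
  | tail _ h ih =>
    rcases h with h | h | h
    · exact ih.trans h.le
    · exact ih.trans h.le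
    · exact ih.trans h.le

lemma Le.refines (h : p.Le p') : p.Refines p' := by
  induction hm : p.numBlocks using Nat.strong_induction_on generalizing p with
  | _ m ih =>
  subst hm
  by_cases h' : p'.Le p
  · exact .single (.inl (equivalent_iff.2 ⟨h, h'⟩))
  have step : ∀ {q : PartialGPartition n G}, p.Le q → ¬ q.Le p → q.Le p' → q.Refines p' := by
    intro q hq hq' hqp
    refine ih _ ?_ hqp rfl
    by_contra hc
    exact hq' (hq.le_of_numBlocks_le (not_lt.1 hc))
  by_cases hS : ∃ i, i ∉ p'.carrier ∧ i ∈ p.carrier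
  · obtain ⟨i, hi', hi⟩ := hS
    have hle := (del_le_iff hi).2 ⟨h, hi'⟩
    refine .head (.inr (.inr (isDeletion_del hi))) (step (isDeletion_del hi).le ?_ hle)
    exact fun hh ↦ hh.1 i (fun h2 ↦ h2.2 (rel_refl hi)) hi
  · have hS' : ∀ i, i ∉ p'.carrier → i ∉ p.carrier := fun i h1 h2 ↦ hS ⟨i, h1, h2⟩
    have : ∃ i j g, p'.Edge i j g ∧ ¬ p.Edge i j g := by
      by_contra hc
      push Not at hc
      exact h' ⟨hS', hc⟩
    obtain ⟨i, j, g, he, hne⟩ := this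
    have hi : i ∈ p'.carrier := by
      by_contra hi
      exact hne (.inl ⟨hS' i hi, hS' j (he.notMem hi)⟩)
    have hi1 := h.mem hi
    have hj1 := h.mem (he.mem hi)
    have hr : ¬ p.Rel i j := by
      intro hr
      have h1 := edge_of_rel hr
      rw [(h.2 _ _ _ h1).unique he hi] at h1
      exact hne h1
    refine .head (.inl (equivalent_relabel (g := g) hi1 hj1))
      (.head (.inr (.inl (isMerging_merge (p := p.relabel i j hi1 hj1 g) hi1 hj1 hr)))
        (step (le_join hi1 hj1 hr) (fun hh ↦ hne (hh.2 _ _ _ (join_edge hi1 hj1 hr)))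
          ((join_le_iff hi1 hj1 hr).2 ⟨h, he⟩)))

lemma refines_iff : p.Refines p' ↔ p.Le p' := ⟨Refines.le, Le.refines⟩

variable (n G) in
/-- Equivalence of partial `G`-partitions. -/
instance setoid : Setoid (PartialGPartition n G) where
  r := Equivalent
  iseqv := ⟨fun p ↦ equivalent_iff.2 ⟨.refl p, .refl p⟩,
    fun h ↦ equivalent_iff.2 (equivalent_iff.1 h).symm,
    fun h h' ↦ equivalent_iff.2 ⟨(equivalent_iff.1 h).1.trans (equivalent_iff.1 h').1,
      (equivalent_iff.1 h').2.trans (equivalent_iff.1 h).2⟩⟩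

end

instance [Finite G] : Finite (PartialGPartition n G) := by
  have : ∀ S : Set (Fin n), Finite (Setoid S) := fun S ↦
    Finite.of_injective (fun s : Setoid S ↦ s.r) fun s t h ↦ Setoid.ext fun a b ↦ by
      exact iff_of_eq (congrFun (congrFun h a) b)
  refine Finite.of_surjective (fun x : Σ S : Set (Fin n), (S → G) × Setoid S ↦
    (⟨x.1, x.2.1, x.2.2⟩ : PartialGPartition n G)) ?_
  rintro ⟨S, f, b⟩
  exact ⟨⟨S, f, b⟩, rfl⟩

end PartialGPartition

/-- The poset of equivalence classes of partial `G`-partitions of `[n]`, ordered by refinement. -/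
def DowlingLattice (n : ℕ) (G : Type*) [Group G] : Type _ := Quotient (PartialGPartition.setoid n G)

namespace DowlingLattice

open PartialGPartition

variable {n : ℕ} {G : Type*} [Group G]

instance [Finite G] : Finite (DowlingLattice n G) :=
  inferInstanceAs (Finite (Quotient (PartialGPartition.setoid n G)))

/-- The class of a partial `G`-partition. -/
def mk (p : PartialGPartition n G) : DowlingLattice n G := Quotient.mk _ p

lemma mk_surj (x : DowlingLattice n G) : ∃ p, mk p = x := Quotient.exists_rep x

/-- The refinement order. -/
instance : PartialOrder (DowlingLattice n G) where
  le := Quotient.lift₂ Refines fun a b c d h h' ↦ by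
    simp only [refines_iff]
    have h := equivalent_iff.1 h
    have h' := equivalent_iff.1 h'
    exact propext ⟨fun hh ↦ (h.2.trans hh).trans h'.1, fun hh ↦ (h.1.trans hh).trans h'.2⟩
  le_refl := by
    rintro ⟨p⟩
    exact refines_iff.2 (.refl p)
  le_trans := by
    rintro ⟨p⟩ ⟨q⟩ ⟨r⟩ h h'
    exact Relation.ReflTransGen.trans h h'
  le_antisymm := by
    rintro ⟨p⟩ ⟨q⟩ h h'
    exact Quotient.sound (equivalent_iff.2 ⟨refines_iff.1 h, refines_iff.1 h'⟩)

lemma mk_le_mk {p q : PartialGPartition n G} : mk p ≤ mk q ↔ p.Le q := refines_iff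

/-- The partition of `[n]` into singletons. -/
def singletons (n : ℕ) (G : Type*) [Group G] : PartialGPartition n G where
  carrier := Set.univ
  label _ := 1
  blocks := ⊥

lemma singletons_rel {i j : Fin n} : (singletons n G).Rel i j ↔ i = j := by
  constructor
  · rintro ⟨_, _, h⟩
    exact congrArg Subtype.val (show (⟨i, _⟩ : (singletons n G).carrier) = ⟨j, _⟩ from h)
  · rintro rfl
    exact rel_refl (Set.mem_univ _)

lemma singletons_edge {i j : Fin n} {g : G} : (singletons n G).Edge i j g ↔ i = j ∧ g = 1 := by
  constructor
  · rintro (⟨h, _⟩ | ⟨_, _, h, he⟩)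
    · exact absurd (Set.mem_univ _) h
    · refine ⟨singletons_rel.1 h, ?_⟩
      simpa [singletons] using he
  · rintro ⟨rfl, rfl⟩
    exact edge_refl _

lemma singletons_le (p : PartialGPartition n G) : (singletons n G).Le p := by
  refine ⟨fun i h ↦ absurd (Set.mem_univ _) h, fun i j g h ↦ ?_⟩
  obtain ⟨rfl, rfl⟩ := singletons_edge.1 h
  exact edge_refl _

instance : OrderBot (DowlingLattice n G) where
  bot := mk (singletons n G)
  bot_le := by
    rintro ⟨p⟩
    exact mk_le_mk.2 (singletons_le p)

/-- The number of blocks. -/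
noncomputable def numBlocks : DowlingLattice n G → ℕ :=
  Quotient.lift PartialGPartition.numBlocks fun _ _ h ↦
    (equivalent_iff.1 h).2.numBlocks_le.antisymm (equivalent_iff.1 h).1.numBlocks_le

/-- The rank of a class of partial `G`-partitions of `[n]` with `k` blocks is `n - k`. -/
noncomputable def rank (x : DowlingLattice n G) : ℕ := n - x.numBlocks

lemma numBlocks_bot : (⊥ : DowlingLattice n G).numBlocks = n := by
  change Nat.card (Quotient (⊥ : Setoid (Set.univ : Set (Fin n)))) = n
  rw [Nat.card_congr (β := Fin n) ⟨Quotient.lift (fun i ↦ i.1) fun a b h ↦ congrArg Subtype.val h,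
    fun i ↦ Quotient.mk _ ⟨i, Set.mem_univ i⟩, fun x ↦ ?_, fun _ ↦ rfl⟩, Nat.card_fin]
  induction x using Quotient.inductionOn
  rfl

lemma numBlocks_anti {x y : DowlingLattice n G} (h : x ≤ y) : y.numBlocks ≤ x.numBlocks := by
  obtain ⟨p, rfl⟩ := mk_surj x
  obtain ⟨q, rfl⟩ := mk_surj y
  exact (mk_le_mk.1 h).numBlocks_le

lemma numBlocks_le (x : DowlingLattice n G) : x.numBlocks ≤ n :=
  (numBlocks_anti bot_le).trans numBlocks_bot.le

lemma rank_bot : (⊥ : DowlingLattice n G).rank = 0 := by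
  rw [rank, numBlocks_bot, Nat.sub_self]

lemma rank_mono {x y : DowlingLattice n G} (h : x ≤ y) : x.rank ≤ y.rank :=
  Nat.sub_le_sub_left (numBlocks_anti h) n

lemma eq_of_rank_le {x y : DowlingLattice n G} (h : x ≤ y) (hr : y.rank ≤ x.rank) : x = y := by
  refine h.antisymm ?_
  have h1 := x.numBlocks_le
  have h2 := y.numBlocks_le
  obtain ⟨p, rfl⟩ := mk_surj x
  obtain ⟨q, rfl⟩ := mk_surj y
  unfold rank at hr
  exact mk_le_mk.2 ((mk_le_mk.1 h).le_of_numBlocks_le (show (mk p).numBlocks ≤ (mk q).numBlocks by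
    omega))

/-- Atoms are the elements given by deleting a singleton or merging two singletons. -/
lemma atom_cases {a : DowlingLattice n G} (ha : IsAtom a) :
    (∃ i, ∀ p : PartialGPartition n G, a ≤ mk p ↔ i ∉ p.carrier) ∨
      ∃ i j g, ∀ p : PartialGPartition n G, a ≤ mk p ↔ p.Edge i j g := by
  obtain ⟨q, rfl⟩ := mk_surj a
  by_cases hS : ∃ i, i ∉ q.carrier
  · obtain ⟨i, hi⟩ := hS
    have hi0 : i ∈ (singletons n G).carrier := Set.mem_univ i
    have key : ∀ p : PartialGPartition n G, ((singletons n G).del i).Le p ↔ i ∉ p.carrier :=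
      fun p ↦ (del_le_iff hi0).trans (and_iff_right (singletons_le p))
    have h1 : mk ((singletons n G).del i) = mk q := by
      refine (ha.le_iff_eq fun h0 ↦ ?_).1 (mk_le_mk.2 ((key q).2 hi))
      exact (key (singletons n G)).1 (mk_le_mk.1 h0.le) hi0
    exact .inl ⟨i, fun p ↦ by rw [← h1, mk_le_mk, key]⟩
  · have hS : ∀ i, i ∈ q.carrier := by simpa using hS
    have : ∃ i j g, q.Edge i j g ∧ ¬ (singletons n G).Edge i j g := by
      by_contra hc
      push Not at hc
      exact ha.1 (le_bot_iff.1 (mk_le_mk.2 ⟨fun i h ↦ absurd (hS i) h, hc⟩))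
    obtain ⟨i, j, g, he, hne⟩ := this
    have hi0 : i ∈ (singletons n G).carrier := Set.mem_univ i
    have hj0 : j ∈ (singletons n G).carrier := Set.mem_univ j
    have hij : ¬ (singletons n G).Rel i j := by
      intro h
      obtain rfl := singletons_rel.1 h
      refine hne (singletons_edge.2 ⟨rfl, he.unique (edge_refl i) (hS i)⟩)
    have key : ∀ p : PartialGPartition n G,
        ((singletons n G).join i j hi0 hj0 g).Le p ↔ p.Edge i j g :=
      fun p ↦ (join_le_iff hi0 hj0 hij).trans (and_iff_right (singletons_le p))
    have h1 : mk ((singletons n G).join i j hi0 hj0 g) = mk q := by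
      refine (ha.le_iff_eq fun h0 ↦ ?_).1 (mk_le_mk.2 ((key q).2 he))
      exact hne ((key (singletons n G)).1 (mk_le_mk.1 h0.le))
    exact .inr ⟨i, j, g, fun p ↦ by rw [← h1, mk_le_mk, key]⟩

/-- The join of an element and an atom exists, and the rank goes up by at most one. -/
lemma exists_join (x : DowlingLattice n G) {a : DowlingLattice n G} (ha : IsAtom a) :
    ∃ z : DowlingLattice n G, (∀ y, z ≤ y ↔ x ≤ y ∧ a ≤ y) ∧ z.rank ≤ x.rank + 1 := by
  suffices ∃ z : DowlingLattice n G, (∀ y, z ≤ y ↔ x ≤ y ∧ a ≤ y) ∧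
      x.numBlocks ≤ z.numBlocks + 1 by
    obtain ⟨z, h1, h2⟩ := this
    exact ⟨z, h1, by unfold rank; omega⟩
  by_cases hax : a ≤ x
  · exact ⟨x, fun y ↦ ⟨fun h ↦ ⟨h, hax.trans h⟩, fun h ↦ h.1⟩, Nat.le_succ _⟩
  obtain ⟨p, rfl⟩ := mk_surj x
  have hdel : ∀ i, i ∈ p.carrier → (∀ q : PartialGPartition n G, p.Le q →
      (i ∉ q.carrier ↔ a ≤ mk q)) → ∃ z : DowlingLattice n G, (∀ y, z ≤ y ↔ mk p ≤ y ∧ a ≤ y) ∧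
      (mk p).numBlocks ≤ z.numBlocks + 1 := by
    intro i hi hq
    refine ⟨mk (p.del i), fun y ↦ ?_, numBlocks_le_del hi⟩
    obtain ⟨q, rfl⟩ := mk_surj y
    rw [mk_le_mk, mk_le_mk, del_le_iff hi]
    exact and_congr_right (hq q)
  rcases atom_cases ha with ⟨i, hai⟩ | ⟨i, j, g, hae⟩
  · refine hdel i ?_ fun q _ ↦ (hai q).symm
    rw [hai] at hax
    exact not_not.1 hax
  · rw [hae] at hax
    by_cases hi : i ∈ p.carrier
    · by_cases hj : j ∈ p.carrier
      · by_cases hr : p.Rel i j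
        · refine hdel i hi fun q hq ↦ ?_
          have h1 := hq.2 _ _ _ (edge_of_rel hr)
          rw [hae]
          constructor
          · exact fun h ↦ edge_of_notMem h (h1.notMem h)
          · intro h hiq
            have h2 := edge_of_rel hr
            rw [h1.unique h hiq] at h2
            exact hax h2
        · refine ⟨mk (p.join i j hi hj g), fun y ↦ ?_, numBlocks_le_join hi hj⟩
          obtain ⟨q, rfl⟩ := mk_surj y
          rw [mk_le_mk, mk_le_mk, hae, join_le_iff hi hj hr]
      · refine hdel i hi fun q hq ↦ ?_
        rw [hae]
        exact ⟨fun h ↦ edge_of_notMem h (hq.1 j hj), fun h ↦ h.symm.notMem (hq.1 j hj)⟩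
    · have hj : j ∈ p.carrier := by
        by_contra hj
        exact hax (edge_of_notMem hi hj)
      refine hdel j hj fun q hq ↦ ?_
      rw [hae]
      exact ⟨fun h ↦ edge_of_notMem (hq.1 i hi) h, fun h ↦ h.notMem (hq.1 i hi)⟩

lemma exists_isLUB_insert {I : Set {a : DowlingLattice n G // IsAtom a}} {z : DowlingLattice n G}
    (hz : IsLUB (Subtype.val '' I) z) (a : {a : DowlingLattice n G // IsAtom a}) :
    ∃ z', IsLUB (Subtype.val '' insert a I) z' ∧ z'.rank ≤ z.rank + 1 ∧
      (¬ a.1 ≤ z → z'.rank = z.rank + 1) := by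
  obtain ⟨z', h1, h2⟩ := exists_join z a.2
  have h3 := (h1 z').1 le_rfl
  refine ⟨z', ?_, h2, fun ha ↦ h2.antisymm ?_⟩
  · rw [isLUB_iff_le_iff]
    intro y
    rw [h1, isLUB_le_iff hz, Set.image_insert_eq, upperBounds_insert]
    exact and_comm
  · by_contra hc
    have := eq_of_rank_le h3.1 (by omega)
    exact ha (this ▸ h3.2)

lemma exists_isLUB_union [Finite G] {I : Set {a : DowlingLattice n G // IsAtom a}}
    {z : DowlingLattice n G} (hz : IsLUB (Subtype.val '' I) z)
    (J : Set {a : DowlingLattice n G // IsAtom a}) :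
    ∃ z', IsLUB (Subtype.val '' (J ∪ I)) z' ∧ z'.rank ≤ z.rank + J.ncard := by
  induction J, J.toFinite using Set.Finite.induction_on with
  | empty => exact ⟨z, by simpa using hz, by simp⟩
  | @insert a J haJ hJ ih =>
    obtain ⟨z', h1, h2⟩ := ih
    obtain ⟨z'', h3, h4, _⟩ := exists_isLUB_insert h1 a
    refine ⟨z'', by rwa [Set.insert_union], ?_⟩
    rw [Set.ncard_insert_of_notMem haJ hJ]
    omega

lemma isLUB_empty_bot :
    IsLUB (Subtype.val '' (∅ : Set {a : DowlingLattice n G // IsAtom a})) ⊥ := by simp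

lemma exists_isLUB [Finite G] (I : Set {a : DowlingLattice n G // IsAtom a}) :
    ∃ z, IsLUB (Subtype.val '' I) z ∧ z.rank ≤ I.ncard := by
  simpa [rank_bot] using exists_isLUB_union isLUB_empty_bot I

end DowlingLattice

/-- The Dowling geometry `Q_n(G)`: the simple matroid on the atoms of the lattice of partial
`G`-partitions of `[n]` for which a set of atoms is independent if the rank of its join is equal to
its cardinality. -/
noncomputable def dowlingGeometry (n : ℕ) (G : Type*) [Group G] [Finite G] :
    Matroid {a : DowlingLattice n G // IsAtom a} :=
  (IndepMatroid.ofFinite (Set.toFinite Set.univ)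
    (fun I ↦ ∃ z : DowlingLattice n G, IsLUB (Subtype.val '' I) z ∧ z.rank = I.ncard)
    ⟨⊥, DowlingLattice.isLUB_empty_bot, by simp [DowlingLattice.rank_bot]⟩
    (by
      rintro I J ⟨z, hz, hr⟩ hIJ
      obtain ⟨w, hw, hwr⟩ := DowlingLattice.exists_isLUB I
      obtain ⟨z', hz', hr'⟩ := DowlingLattice.exists_isLUB_union hw (J \ I)
      rw [Set.sdiff_union_of_subset hIJ] at hz'
      obtain rfl := hz.unique hz'
      have := Set.ncard_sdiff_add_ncard_of_subset hIJ
      exact ⟨w, hw, by omega⟩)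
    (by
      rintro I J ⟨z, hz, hr⟩ ⟨w, hw, hwr⟩ hlt
      have : ∃ e ∈ J, ¬ e.1 ≤ z := by
        by_contra hc
        push Not at hc
        have : w ≤ z := (isLUB_le_iff hw).2 (by rintro _ ⟨e, he, rfl⟩; exact hc e he)
        have := DowlingLattice.rank_mono this
        omega
      obtain ⟨e, heJ, he⟩ := this
      have heI : e ∉ I := fun h ↦ he (hz.1 ⟨e, h, rfl⟩)
      obtain ⟨z', h1, _, h2⟩ := DowlingLattice.exists_isLUB_insert hz e
      exact ⟨e, heJ, heI, z', h1, by rw [h2 he, Set.ncard_insert_of_notMem heI, hr]⟩)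
    (fun _ _ ↦ Set.subset_univ _)).matroid

namespace DowlingLattice

open PartialGPartition

variable {n : ℕ} {G : Type*} [Group G]

lemma isAtom_of_rank_le {x : DowlingLattice n G} (h0 : x ≠ ⊥) (h1 : x.rank ≤ 1) : IsAtom x := by
  refine ⟨h0, fun y hy ↦ ?_⟩
  have h2 : y.rank < x.rank := by
    by_contra hc
    exact hy.ne (eq_of_rank_le hy.le (not_lt.1 hc))
  exact (eq_of_rank_le bot_le (by omega)).symm

/-- The lattice is atomistic. -/
lemma le_of_forall_atom {x y : DowlingLattice n G} (h : ∀ a, IsAtom a → a ≤ x → a ≤ y) :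
    x ≤ y := by
  obtain ⟨p, rfl⟩ := mk_surj x
  obtain ⟨q, rfl⟩ := mk_surj y
  have hb := numBlocks_bot (n := n) (G := G)
  have hmem : ∀ i, i ∉ p.carrier → i ∉ q.carrier := by
    intro i hi
    have hi0 : i ∈ (singletons n G).carrier := Set.mem_univ i
    have key : ∀ p : PartialGPartition n G, mk ((singletons n G).del i) ≤ mk p ↔ i ∉ p.carrier :=
      fun p ↦ mk_le_mk.trans ((del_le_iff hi0).trans (and_iff_right (singletons_le p)))
    refine (key q).1 (h _ (isAtom_of_rank_le (fun h0 ↦ (key _).1 h0.le hi0) ?_) ((key p).2 hi))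
    have : (⊥ : DowlingLattice n G).numBlocks ≤ (mk ((singletons n G).del i)).numBlocks + 1 :=
      numBlocks_le_del hi0
    unfold rank
    omega
  refine mk_le_mk.2 ⟨hmem, fun i j g he ↦ ?_⟩
  by_cases hij : i = j
  · subst hij
    by_cases hi : i ∈ p.carrier
    · rw [he.unique (edge_refl i) hi]
      exact edge_refl i
    · exact edge_of_notMem (hmem i hi) (hmem i hi)
  have hi0 : i ∈ (singletons n G).carrier := Set.mem_univ i
  have hj0 : j ∈ (singletons n G).carrier := Set.mem_univ j
  have key : ∀ p : PartialGPartition n G,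
      mk ((singletons n G).join i j hi0 hj0 g) ≤ mk p ↔ p.Edge i j g :=
    fun p ↦ mk_le_mk.trans ((join_le_iff hi0 hj0 fun h ↦ hij (singletons_rel.1 h)).trans
      (and_iff_right (singletons_le p)))
  refine (key q).1 (h _ (isAtom_of_rank_le
    (fun h0 ↦ hij (singletons_edge.1 ((key _).1 h0.le)).1) ?_) ((key p).2 he))
  have : (⊥ : DowlingLattice n G).numBlocks ≤
      (mk ((singletons n G).join i j hi0 hj0 g)).numBlocks + 1 := numBlocks_le_join hi0 hj0
  unfold rank
  omega

end DowlingLattice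

section flats

variable {n : ℕ} {G : Type*} [Group G] [Finite G]

lemma dowlingGeometry_indep_iff {I : Set {a : DowlingLattice n G // IsAtom a}} :
    (dowlingGeometry n G).Indep I ↔
      ∃ z : DowlingLattice n G, IsLUB (Subtype.val '' I) z ∧ z.rank = I.ncard := by
  simp [dowlingGeometry]

lemma dowlingGeometry_ground : (dowlingGeometry n G).E = Set.univ := rfl

lemma dowlingGeometry_closure {X : Set {a : DowlingLattice n G // IsAtom a}}
    {z : DowlingLattice n G} (hz : IsLUB (Subtype.val '' X) z) :
    (dowlingGeometry n G).closure X = {a | a.1 ≤ z} := by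
  obtain ⟨I, hI⟩ := (dowlingGeometry n G).exists_isBasis X (Set.subset_univ X)
  obtain ⟨w, hw, hr⟩ := dowlingGeometry_indep_iff.1 hI.indep
  have key : (dowlingGeometry n G).closure I = {a | a.1 ≤ w} := by
    ext a
    rw [hI.indep.mem_closure_iff', Set.mem_ofPred_eq]
    constructor
    · rintro ⟨_, h⟩
      by_contra ha
      obtain ⟨w', h1, _, h2⟩ := DowlingLattice.exists_isLUB_insert hw a
      have haI : a ∉ I := fun h ↦ ha (hw.1 ⟨a, h, rfl⟩)
      exact haI (h (dowlingGeometry_indep_iff.2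
        ⟨w', h1, by rw [h2 ha, Set.ncard_insert_of_notMem haI, hr]⟩))
    · refine fun ha ↦ ⟨Set.mem_univ _, fun h ↦ ?_⟩
      by_contra haI
      obtain ⟨w', hw', hr'⟩ := dowlingGeometry_indep_iff.1 h
      rw [Set.ncard_insert_of_notMem haI] at hr'
      have : w' ≤ w := (isLUB_le_iff hw').2 (by
        rintro _ ⟨b, rfl | hb, rfl⟩
        · exact ha
        · exact hw.1 ⟨b, hb, rfl⟩)
      have := DowlingLattice.rank_mono this
      omega
  have hwz : w = z := by
    refine le_antisymm ((isLUB_le_iff hw).2 ?_) ((isLUB_le_iff hz).2 ?_)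
    · rintro _ ⟨b, hb, rfl⟩
      exact hz.1 ⟨b, hI.subset hb, rfl⟩
    · rintro _ ⟨b, hb, rfl⟩
      have : b ∈ (dowlingGeometry n G).closure I := hI.subset_closure hb
      rwa [key] at this
  rw [← hI.closure_eq_closure, key, hwz]

/-- The lattice of partial `G`-partitions is the lattice of flats of the Dowling geometry. -/
theorem dowlingGeometry_flats : ∃ e : DowlingLattice n G ≃o
    {F : Set {a : DowlingLattice n G // IsAtom a} // (dowlingGeometry n G).IsFlat F},
    ∀ x, (e x).1 = {a | a.1 ≤ x} := by
  have hlub : ∀ x : DowlingLattice n G,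
      IsLUB (Subtype.val '' {a : {a : DowlingLattice n G // IsAtom a} | a.1 ≤ x}) x := by
    intro x
    refine ⟨by rintro _ ⟨b, hb, rfl⟩; exact hb, fun y hy ↦ ?_⟩
    exact DowlingLattice.le_of_forall_atom fun a ha hax ↦ hy ⟨⟨a, ha⟩, hax, rfl⟩
  let f : DowlingLattice n G ↪o
      {F : Set {a : DowlingLattice n G // IsAtom a} // (dowlingGeometry n G).IsFlat F} :=
    OrderEmbedding.ofMapLEIff (fun x ↦ ⟨{a | a.1 ≤ x}, by
      rw [Matroid.isFlat_iff_closure_eq, dowlingGeometry_closure (hlub x)]⟩) (by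
      intro x y
      constructor
      · exact fun h ↦ DowlingLattice.le_of_forall_atom fun a ha hax ↦ h (a := ⟨a, ha⟩) hax
      · exact fun h a ha ↦ le_trans ha h)
  refine ⟨RelIso.ofSurjective f ?_, fun x ↦ rfl⟩
  rintro ⟨F, hF⟩
  obtain ⟨z, hz, _⟩ := DowlingLattice.exists_isLUB F
  exact ⟨z, Subtype.ext ((dowlingGeometry_closure hz).symm.trans hF.closure)⟩

/-- The Dowling geometry is loopless. -/
lemma dowlingGeometry_loopless : (dowlingGeometry n G).Loopless := by
  rw [Matroid.loopless_iff]
  refine (dowlingGeometry_closure DowlingLattice.isLUB_empty_bot).trans ?_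
  ext a
  simpa using a.2.1

end flats

/-- A polynomial is real-rooted if all of its complex roots are real. -/
def IsRealRooted (p : Polynomial ℤ) : Prop := ∀ z : ℂ, Polynomial.aeval z p = 0 → z.im = 0

/-! Both polynomials depend on `G` only through its order `m`. An upper interval of the lattice
above an element with `k` blocks is again a Dowling lattice, on `k` letters
(`DowlingLattice.exists_ici_orderIso`), so every contraction entering the recursion has the
Kazhdan–Lusztig polynomial `p k` of rank `k`. Sums over the lattice are computed one letter at a
time: a new letter is left outside the subset, forms a singleton, or joins one of `k` blocks with
one of `m` labels. Hence the sum of `X ^ rank * f (number of blocks)` is the value at `0` of the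
`n`-th iterate of `f ↦ ((1 + m k) X f k + f (k + 1))` (`DowlingLattice.finsum_dowlingLattice`). With
palindromicity this determines all `p n`, and the coefficients are polynomials in `u = m - 1` that
can be computed explicitly (`DowlingKL.isKLSequence_klCoeffs`, `DowlingLattice.klPoly_eq`).

For real-rootedness it suffices that a polynomial of degree `d` with positive leading coefficient
alternates in sign at `d` decreasing real points: the behaviour at minus infinity supplies one more
sign change, and the intermediate value theorem then gives `d` distinct real roots
(`splits_of_alternating`). The points are rational functions of `u`. After clearing denominators,
each sign condition says that an integer polynomial in `u` is positive for all `u ≥ 0`, and this is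
read off from a positive constant term and nonnegative other coefficients. So one finite computation
for each `n ≤ 15` covers all finite groups at once (`DowlingKL.alternates_coeffs`). -/

/-! ## Polynomials whose coefficients are polynomials in a parameter -/

namespace ListPoly

open Polynomial

/-- The sum of two coefficient lists. -/
def add : List ℤ → List ℤ → List ℤ
  | [], b => b
  | a, [] => a
  | x :: a, y :: b => (x + y) :: add a b

/-- A multiple of a coefficient list. -/
def smul (c : ℤ) (a : List ℤ) : List ℤ := a.map (c * ·)

/-- The difference of two coefficient lists. -/
def sub (a b : List ℤ) : List ℤ := add a (smul (-1) b)

/-- The product of two coefficient lists. -/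
def mul : List ℤ → List ℤ → List ℤ
  | [], _ => []
  | x :: a, b => add (smul x b) (0 :: mul a b)

/-- A power of a coefficient list. -/
def pow (a : List ℤ) : ℕ → List ℤ
  | 0 => [1]
  | n + 1 => mul a (pow a n)

/-- The test for a positive constant coefficient and nonnegative coefficients. -/
def isPos : List ℤ → Bool
  | [] => false
  | x :: a => decide (0 < x) && a.all fun y ↦ decide (0 ≤ y)

/-- The sum of two lists of coefficient lists. -/
def add₂ : List (List ℤ) → List (List ℤ) → List (List ℤ)
  | [], b => b
  | a, [] => a
  | x :: a, y :: b => add x y :: add₂ a b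

/-- The numerator and the denominator of the value at `A / B` of a polynomial whose coefficients are
polynomials in a parameter. -/
def evalDiv (A B : List ℤ) : List (List ℤ) → List ℤ × List ℤ
  | [] => ([], [1])
  | c :: L =>
    let r := evalDiv A B L
    let q := mul B r.2
    (add (mul q c) (mul A r.1), q)

/-- The value of a coefficient list at `u`. -/
def ev (u : ℤ) : List ℤ → ℤ
  | [] => 0
  | x :: a => x + u * ev u a

/-- The polynomial given by a list of coefficient lists, at the parameter `u`. -/
noncomputable def toPoly (u : ℤ) : List (List ℤ) → ℤ[X]
  | [] => 0
  | c :: L => C (ev u c) + X * toPoly u L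

variable {u : ℤ}

lemma ev_add (a b : List ℤ) : ev u (add a b) = ev u a + ev u b := by
  induction a generalizing b with
  | nil => simp [add, ev]
  | cons x a ih =>
    cases b with
    | nil => simp [add, ev]
    | cons y b => simp only [add, ev, ih]; ring

lemma ev_smul (c : ℤ) (a : List ℤ) : ev u (smul c a) = c * ev u a := by
  induction a with
  | nil => simp [smul, ev]
  | cons x a ih =>
    simp only [smul, List.map_cons, ev] at ih ⊢
    rw [ih]; ring

lemma ev_sub (a b : List ℤ) : ev u (sub a b) = ev u a - ev u b := by
  rw [sub, ev_add, ev_smul]; ring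

lemma ev_mul (a b : List ℤ) : ev u (mul a b) = ev u a * ev u b := by
  induction a with
  | nil => simp [mul, ev]
  | cons x a ih => simp only [mul, ev_add, ev_smul, ev, ih]; ring

lemma ev_nonneg (hu : 0 ≤ u) {a : List ℤ} (h : ∀ x ∈ a, 0 ≤ x) : 0 ≤ ev u a := by
  induction a with
  | nil => simp [ev]
  | cons x a ih =>
    simp only [List.forall_mem_cons] at h
    exact add_nonneg h.1 (mul_nonneg hu (ih h.2))

/-- This is what makes a finite check uniform in the group order. The constant term must be strictly
positive because `u = 0`, the trivial group, is allowed. -/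
lemma ev_pos (hu : 0 ≤ u) {a : List ℤ} (h : isPos a) : 0 < ev u a := by
  cases a with
  | nil => simp [isPos] at h
  | cons x a =>
    simp only [isPos, Bool.and_eq_true, decide_eq_true_eq, List.all_eq_true] at h
    exact add_pos_of_pos_of_nonneg h.1 (mul_nonneg hu (ev_nonneg hu h.2))

lemma toPoly_add₂ (a b : List (List ℤ)) : toPoly u (add₂ a b) = toPoly u a + toPoly u b := by
  induction a generalizing b with
  | nil => simp [add₂, toPoly]
  | cons x a ih =>
    cases b with
    | nil => simp [add₂, toPoly]
    | cons y b => simp only [add₂, toPoly, ih, ev_add, C_add]; ring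

lemma toPoly_map_mul (c : List ℤ) (L : List (List ℤ)) :
    toPoly u (L.map (mul c)) = C (ev u c) * toPoly u L := by
  induction L with
  | nil => simp [toPoly]
  | cons x L ih => simp only [List.map_cons, toPoly, ih, ev_mul, C_mul]; ring

lemma coeff_toPoly (L : List (List ℤ)) (i : ℕ) : (toPoly u L).coeff i = ev u (L.getD i []) := by
  induction L generalizing i with
  | nil => simp [toPoly, ev]
  | cons x L ih =>
    cases i with
    | zero => simp [toPoly]
    | succ i => rw [toPoly, coeff_add, coeff_C_succ, coeff_X_mul, zero_add, ih, List.getD_cons_succ]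

/-- The hypothesis also excludes the empty list, whose default last entry `[]` evaluates to zero, so
the subtraction is not truncated. -/
lemma natDegree_toPoly {L : List (List ℤ)} (h : ev u (L.getLastD []) ≠ 0) :
    (toPoly u L).natDegree = L.length - 1 := by
  rw [List.getLastD_eq_getLast?, List.getLast?_eq_getElem?, ← List.getD_eq_getElem?_getD,
    ← coeff_toPoly] at h
  refine natDegree_eq_of_le_of_coeff_ne_zero ?_ h
  rw [natDegree_le_iff_coeff_eq_zero]
  intro i hi
  rw [coeff_toPoly, List.getD_eq_default _ _ (by omega), ev]

lemma leadingCoeff_toPoly {L : List (List ℤ)} (h : ev u (L.getLastD []) ≠ 0) :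
    (toPoly u L).leadingCoeff = ev u (L.getLastD []) := by
  rw [leadingCoeff, natDegree_toPoly h, coeff_toPoly, List.getLastD_eq_getLast?,
    List.getLast?_eq_getElem?, ← List.getD_eq_getElem?_getD]

lemma ev_evalDiv_snd (A B : List ℤ) (L : List (List ℤ)) :
    ev u (evalDiv A B L).2 = ev u B ^ L.length := by
  induction L with
  | nil => simp [evalDiv, ev]
  | cons c L ih => simp only [evalDiv, ev_mul, ih, List.length_cons, pow_succ']

/-- Horner's scheme with a common denominator. When `B` is positive, the integer numerator has the
sign of the value at `A / B`. -/
lemma ev_evalDiv_fst (A B : List ℤ) (L : List (List ℤ)) (hB : ev u B ≠ 0) :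
    (ev u (evalDiv A B L).1 : ℝ) =
      (ev u B : ℝ) ^ L.length * aeval ((ev u A : ℝ) / ev u B) (toPoly u L) := by
  induction L with
  | nil => simp [evalDiv, ev, toPoly]
  | cons c L ih =>
    have hB' : (ev u B : ℝ) ≠ 0 := by exact_mod_cast hB
    simp only [evalDiv, ev_add, ev_mul, ev_evalDiv_snd, toPoly, Int.cast_add, Int.cast_mul,
      Int.cast_pow, ih, map_add, map_mul, aeval_X, eq_intCast, map_intCast, List.length_cons, pow_succ]
    field_simp

end ListPoly

/-! ## The recursion for the Kazhdan–Lusztig polynomials of Dowling geometries -/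

namespace DowlingKL

open Polynomial ListPoly

/-- The operator on sequences of polynomials whose iterates compute sums over Dowling lattices, see
`DowlingLattice.finsum_dowlingLattice`. -/
noncomputable def latticeOp (m : ℤ) (f : ℕ → ℤ[X]) (k : ℕ) : ℤ[X] :=
  C (1 + m * k) * X * f k + f (k + 1)

/-- The recursion for the Kazhdan–Lusztig polynomials of the Dowling geometries of a group of order
`m`. -/
structure IsKLSequence (m : ℤ) (p : ℕ → ℤ[X]) : Prop where
  zero : p 0 = 1
  coeff : ∀ n ≠ 0, ∀ i, (p n).coeff i = if 2 * i < n then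
    ((latticeOp m)^[n] p 0 - p n).coeff (n - i) - ((latticeOp m)^[n] p 0 - p n).coeff i else 0

/-- The antidiagonal of the iterates of `latticeOp` that comes after `A` and begins with `q`. -/
def nextDiag : ℕ → List (List (List ℤ)) → List (List ℤ) → List (List (List ℤ))
  | _, [], q => [q]
  | k, a :: A, q => q :: nextDiag (k - 1) A (add₂ q ([] :: a.map (mul [1 + (k : ℤ), (k : ℤ)])))

/-- The last entry of an antidiagonal. -/
def lastEntry : List (List (List ℤ)) → List (List ℤ)
  | [] => []
  | [a] => a
  | _ :: a :: A => lastEntry (a :: A)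

/-- The polynomial of degree less than `n / 2` whose sum with `R` is palindromic of degree `n`. -/
def palindromicPart (n : ℕ) (R : List (List ℤ)) : List (List ℤ) :=
  (List.range ((n + 1) / 2)).map fun i ↦ sub (R.getD (n - i) []) (R.getD i [])

/-- The antidiagonals of the iterates of `latticeOp` on the Kazhdan–Lusztig polynomials, as
polynomials in the order of the group minus one. -/
def diag : ℕ → List (List (List ℤ))
  | 0 => [[[1]]]
  | n + 1 =>
    let A := diag n
    nextDiag n A (palindromicPart (n + 1) (lastEntry (nextDiag n A [])))

/-- The coefficients of the Kazhdan–Lusztig polynomials of Dowling geometries. -/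
def klCoeffs (n : ℕ) : List (List ℤ) := (diag n).headD []

/-- The coefficients of the `Z`-polynomials of Dowling geometries. -/
def zCoeffs (n : ℕ) : List (List ℤ) := lastEntry (diag n)

/-- The antidiagonal of the iterates of `latticeOp` from `(s, k)` to `(s + k, 0)`. -/
noncomputable def opDiag (m : ℤ) (p : ℕ → ℤ[X]) : ℕ → ℕ → List ℤ[X]
  | s, 0 => [(latticeOp m)^[s] p 0]
  | s, k + 1 => (latticeOp m)^[s] p (k + 1) :: opDiag m p (s + 1) k

variable {u : ℤ}

lemma nextDiag_ne_nil (k : ℕ) (A : List (List (List ℤ))) (q : List (List ℤ)) :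
    nextDiag k A q ≠ [] := by
  cases A <;> simp [nextDiag]

lemma headD_nextDiag (k : ℕ) (A : List (List (List ℤ))) (q : List (List ℤ)) :
    (nextDiag k A q).headD [] = q := by
  cases A <;> simp [nextDiag]

lemma lastEntry_cons (a : List (List ℤ)) {A : List (List (List ℤ))} (h : A ≠ []) :
    lastEntry (a :: A) = lastEntry A := by
  cases A with
  | nil => exact absurd rfl h
  | cons b A => rfl

/-- With `m = u + 1` the factor `1 + m k` is `(1 + k) + k u`; the leading `[]` is the factor `X`. -/
lemma toPoly_shift (k : ℕ) (a : List (List ℤ)) :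
    toPoly u ([] :: a.map (mul [1 + (k : ℤ), (k : ℤ)])) =
      C (1 + (u + 1) * k) * X * toPoly u a := by
  have : ev u [1 + (k : ℤ), (k : ℤ)] = 1 + (u + 1) * k := by simp only [ev]; ring
  rw [toPoly, toPoly_map_mul, this]
  simp only [ev, C_0]; ring

/-- The iterate `s + 1` at `k` needs only the iterate `s` at `k` and at `k + 1`. The first lies on
the previous antidiagonal and the second was just computed, so `q` is the only new datum. -/
lemma map_nextDiag {p : ℕ → ℤ[X]} (k : ℕ) (s : ℕ) {A : List (List (List ℤ))} {q : List (List ℤ)}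
    (hA : A.map (toPoly u) = opDiag (u + 1) p s k)
    (hq : toPoly u q = (latticeOp (u + 1))^[s] p (k + 1)) :
    (nextDiag k A q).map (toPoly u) = opDiag (u + 1) p s (k + 1) := by
  have key : ∀ k s (a q : List (List ℤ)), toPoly u a = (latticeOp (u + 1))^[s] p k →
      toPoly u q = (latticeOp (u + 1))^[s] p (k + 1) →
      toPoly u (add₂ q ([] :: a.map (mul [1 + (k : ℤ), (k : ℤ)]))) =
        (latticeOp (u + 1))^[s + 1] p k := by
    intro k s a q ha hq
    rw [toPoly_add₂, toPoly_shift, ha, hq, Function.iterate_succ_apply', latticeOp, add_comm]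
  induction k generalizing s A q with
  | zero =>
    obtain ⟨a, rfl, ha⟩ : ∃ a, A = [a] ∧ toPoly u a = (latticeOp (u + 1))^[s] p 0 := by
      simpa [opDiag, List.map_eq_cons_iff] using hA
    simp only [nextDiag, List.map_cons, List.map_nil, opDiag, hq, key 0 s a q ha hq]
  | succ k ih =>
    obtain ⟨a, A, rfl, ha, hA'⟩ := List.map_eq_cons_iff.1 hA
    rw [nextDiag, List.map_cons, hq, opDiag, Nat.add_sub_cancel]
    rw [ih (s + 1) hA' (key (k + 1) s a q ha hq)]

lemma toPoly_lastEntry {p : ℕ → ℤ[X]} (k : ℕ) (s : ℕ) {A : List (List (List ℤ))}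
    (hA : A.map (toPoly u) = opDiag (u + 1) p s k) :
    toPoly u (lastEntry A) = (latticeOp (u + 1))^[s + k] p 0 := by
  induction k generalizing s A with
  | zero =>
    obtain ⟨a, rfl, ha⟩ : ∃ a, A = [a] ∧ toPoly u a = (latticeOp (u + 1))^[s] p 0 := by
      simpa [opDiag, List.map_eq_cons_iff] using hA
    simpa [lastEntry] using ha
  | succ k ih =>
    obtain ⟨a, A, rfl, ha, hA'⟩ := List.map_eq_cons_iff.1 hA
    rw [lastEntry_cons, ih (s + 1) hA', Nat.add_right_comm, Nat.add_assoc]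
    rintro rfl
    cases k <;> simp [opDiag] at hA'

/-- The first entry is passed down the antidiagonal with coefficient one. The sum over the lattice
without its bottom term is therefore available before the new Kazhdan–Lusztig polynomial is known:
put zero in its place. -/
lemma toPoly_lastEntry_nextDiag (k : ℕ) (A : List (List (List ℤ))) (q : List (List ℤ)) :
    toPoly u (lastEntry (nextDiag k A q)) =
      toPoly u (lastEntry (nextDiag k A [])) + toPoly u q := by
  induction A generalizing k q with
  | nil => simp [nextDiag, lastEntry, toPoly]
  | cons a A ih =>
    rw [nextDiag, lastEntry_cons _ (nextDiag_ne_nil _ _ _), nextDiag,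
      lastEntry_cons _ (nextDiag_ne_nil _ _ _), ih, ih (q := add₂ [] _), toPoly_add₂, toPoly_add₂]
    simp only [toPoly]; ring

lemma coeff_palindromicPart (n : ℕ) (R : List (List ℤ)) (i : ℕ) :
    (toPoly u (palindromicPart n R)).coeff i = if 2 * i < n then
      (toPoly u R).coeff (n - i) - (toPoly u R).coeff i else 0 := by
  simp only [coeff_toPoly]
  split_ifs with h
  · rw [palindromicPart, List.getD_eq_getElem _ _ (by simp; omega)]
    simp [ev_sub]
  · rw [palindromicPart, List.getD_eq_default _ _ (by simp; omega), ev]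

lemma klCoeffs_succ (n : ℕ) : klCoeffs (n + 1) =
    palindromicPart (n + 1) (lastEntry (nextDiag n (diag n) [])) :=
  headD_nextDiag _ _ _

lemma map_diag (n : ℕ) :
    (diag n).map (toPoly u) = opDiag (u + 1) (fun n ↦ toPoly u (klCoeffs n)) 0 n := by
  induction n with
  | zero => simp [diag, opDiag, klCoeffs]
  | succ n ih =>
    exact map_nextDiag n 0 ih (by rw [← klCoeffs_succ]; rfl)

lemma toPoly_zCoeffs (n : ℕ) :
    toPoly u (zCoeffs n) = (latticeOp (u + 1))^[n] (fun n ↦ toPoly u (klCoeffs n)) 0 := by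
  simpa [zCoeffs] using toPoly_lastEntry n 0 (map_diag (u := u) n)

theorem isKLSequence_klCoeffs : IsKLSequence (u + 1) fun n ↦ toPoly u (klCoeffs n) := by
  refine ⟨by simp [klCoeffs, diag, toPoly, ev], fun n hn i ↦ ?_⟩
  obtain ⟨n, rfl⟩ := Nat.exists_eq_succ_of_ne_zero hn
  -- Both sides are the contribution of the elements other than the bottom, from which
  -- `palindromicPart` extracts the next polynomial.
  have h : toPoly u (lastEntry (nextDiag n (diag n) [])) =
      (latticeOp (u + 1))^[n + 1] (fun n ↦ toPoly u (klCoeffs n)) 0 -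
        toPoly u (klCoeffs (n + 1)) := by
    rw [eq_sub_iff_add_eq, ← toPoly_zCoeffs, klCoeffs_succ, zCoeffs, diag,
      toPoly_lastEntry_nextDiag _ _ (palindromicPart _ _)]
  rw [← h, klCoeffs_succ, coeff_palindromicPart]

end DowlingKL

/-! ## A criterion for real-rootedness -/

section realRooted

open Polynomial

/-- The polynomial `(-1) ^ d * q (-X)` has the same positive leading coefficient, so it tends to
plus infinity. -/
lemma exists_lt_alternating_eval {q : ℝ[X]} (hd : 0 < q.natDegree) (hl : 0 < q.leadingCoeff)
    (a : ℝ) : ∃ y < a, 0 < (-1) ^ q.natDegree * q.eval y := by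
  have h1 : (q.comp (-X)).natDegree = q.natDegree := by
    rw [natDegree_comp, natDegree_neg, natDegree_X, mul_one]
  have h2 : (C ((-1 : ℝ) ^ q.natDegree) * q.comp (-X)).leadingCoeff = q.leadingCoeff := by
    rw [leadingCoeff_mul, leadingCoeff_C, leadingCoeff_comp (by simp), leadingCoeff_neg,
      leadingCoeff_X, mul_left_comm, ← mul_pow]
    simp
  have h3 : 0 < (C ((-1 : ℝ) ^ q.natDegree) * q.comp (-X)).degree := by
    rw [← natDegree_pos_iff_degree_pos, natDegree_C_mul (by simp), h1]
    exact hd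
  have h4 := tendsto_atTop_of_leadingCoeff_nonneg _ h3 (h2 ▸ hl.le)
  obtain ⟨y, hy1, hy2⟩ := ((h4.eventually_gt_atTop 0).and (Filter.eventually_gt_atTop (-a))).exists
  exact ⟨-y, by linarith, by simpa using hy1⟩

lemma splits_of_alternating {q : ℝ[X]} (hl : 0 < q.leadingCoeff) (x : ℕ → ℝ)
    (hx : ∀ i, i + 1 < q.natDegree → x (i + 1) < x i)
    (hs : ∀ i < q.natDegree, 0 < (-1) ^ i * q.eval (x i)) : q.Splits := by
  rcases Nat.eq_zero_or_pos q.natDegree with hd | hd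
  · rw [natDegree_eq_zero] at hd
    obtain ⟨c, rfl⟩ := hd
    exact Splits.C c
  obtain ⟨y, hy, hys⟩ := exists_lt_alternating_eval hd hl (x (q.natDegree - 1))
  -- The point `y` near minus infinity is appended with index `d`, giving `d + 1` points and `d`
  -- sign changes.
  let x' : ℕ → ℝ := fun i ↦ if i < q.natDegree then x i else y
  have hx' : ∀ i < q.natDegree, x' (i + 1) < x' i := by
    intro i hi
    simp only [x', if_pos hi]
    split_ifs with h
    · exact hx i h
    · rwa [show i = q.natDegree - 1 by omega]
  have hs' : ∀ i ≤ q.natDegree, 0 < (-1) ^ i * q.eval (x' i) := by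
    intro i hi
    simp only [x']
    split_ifs with h
    · exact hs i h
    · rwa [show i = q.natDegree by omega]
  have hr : ∀ i : Fin q.natDegree, ∃ r, x' (i + 1) < r ∧ r < x' i ∧ q.IsRoot r := by
    intro ⟨i, hi⟩
    have h1 := hs' i hi.le
    have h2 := hs' (i + 1) hi
    rw [pow_succ, mul_neg_one, neg_mul] at h2
    rcases neg_one_pow_eq_or ℝ i with h | h <;> rw [h] at h1 h2
    · obtain ⟨r, hr, h0⟩ := intermediate_value_Ioo (hx' i hi).le q.continuous.continuousOn
        (show (0 : ℝ) ∈ Set.Ioo _ _ from ⟨by linarith, by linarith⟩)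
      exact ⟨r, hr.1, hr.2, h0⟩
    · obtain ⟨r, hr, h0⟩ := intermediate_value_Ioo' (hx' i hi).le q.continuous.continuousOn
        (show (0 : ℝ) ∈ Set.Ioo _ _ from ⟨by linarith, by linarith⟩)
      exact ⟨r, hr.1, hr.2, h0⟩
  choose r hr1 hr2 hr3 using hr
  have hanti : ∀ i j, i ≤ j → j ≤ q.natDegree → x' j ≤ x' i := by
    intro i j hij
    induction j, hij using Nat.le_induction with
    | base => exact fun _ ↦ le_rfl
    | succ j hij ih => exact fun hj ↦ (hx' j hj).le.trans (ih (by omega))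
  -- The roots lie in disjoint open intervals between consecutive points, so they are distinct and
  -- exhaust the degree.
  have hinj : Function.Injective r := by
    refine StrictAnti.injective fun i j hij ↦ ?_
    exact (hr2 j).trans_le ((hanti _ _ hij j.2.le).trans (hr1 i).le)
  have hq : q ≠ 0 := leadingCoeff_ne_zero.1 hl.ne'
  rw [splits_iff_card_roots]
  refine le_antisymm q.card_roots' ?_
  have h1 : (Finset.univ.image r).card = q.natDegree := by
    rw [Finset.card_image_of_injective _ hinj, Finset.card_univ, Fintype.card_fin]
  rw [← h1]
  refine (Finset.card_le_card fun t ht ↦ ?_).trans q.roots.toFinset_card_le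
  obtain ⟨i, _, rfl⟩ := Finset.mem_image.1 ht
  exact Multiset.mem_toFinset.2 ((mem_roots hq).2 (hr3 i))

/-- A polynomial of degree `d` with a positive leading coefficient is real-rooted if its signs
alternate, beginning with a positive one, at the members of a decreasing sequence of length `d`. -/
lemma isRealRooted_of_alternating {p : ℤ[X]} (hl : 0 < p.leadingCoeff) (x : ℕ → ℝ)
    (hx : ∀ i, i + 1 < p.natDegree → x (i + 1) < x i)
    (hs : ∀ i < p.natDegree, 0 < (-1) ^ i * aeval (x i) p) : IsRealRooted p := by
  have hinj : Function.Injective (algebraMap ℤ ℝ) := Int.cast_injective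
  have hdeg : (p.map (algebraMap ℤ ℝ)).natDegree = p.natDegree :=
    natDegree_map_eq_of_injective hinj p
  have hsp : (p.map (algebraMap ℤ ℝ)).Splits := by
    refine splits_of_alternating ?_ x (hdeg ▸ hx) ?_
    · rw [leadingCoeff_map_of_injective hinj]
      simpa using hl
    · simpa only [hdeg, eval_map_algebraMap] using hs
  intro z hz
  have h0 : p.map (algebraMap ℤ ℝ) ≠ 0 :=
    (Polynomial.map_ne_zero_iff hinj).2 (leadingCoeff_ne_zero.1 hl.ne')
  have hz' : ((p.map (algebraMap ℤ ℝ)).map (algebraMap ℝ ℂ)).IsRoot z := by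
    rw [IsRoot, eval_map_algebraMap, aeval_map_algebraMap, hz]
  obtain ⟨r, rfl⟩ := hsp.mem_range_of_isRoot h0 hz'
  simp

end realRooted

/-! ### Sign certificates uniform in the order of the group -/

namespace DowlingKL

open Polynomial ListPoly

/-- The test for a positive leading coefficient and for alternating signs at a decreasing sequence of
points, given by their numerators and denominators. -/
def alternates (L : List (List ℤ)) (x : ℕ → List ℤ × List ℤ) : Bool :=
  isPos (L.getLastD []) && ((List.range (L.length - 1)).all fun i ↦
    isPos (x i).2 && isPos (smul ((-1) ^ i) (evalDiv (x i).1 (x i).2 L).1)) &&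
  (List.range (L.length - 2)).all fun i ↦
    isPos (sub (mul (x i).1 (x (i + 1)).2) (mul (x (i + 1)).1 (x i).2))

lemma isRealRooted_of_alternates {u : ℤ} (hu : 0 ≤ u) {L : List (List ℤ)}
    {x : ℕ → List ℤ × List ℤ} (h : alternates L x) : IsRealRooted (toPoly u L) := by
  simp only [alternates, Bool.and_eq_true, List.all_eq_true, List.mem_range] at h
  obtain ⟨⟨h1, h2⟩, h3⟩ := h
  have hlast := ev_pos hu h1
  have hden : ∀ i < L.length - 1, (0 : ℝ) < ev u (x i).2 := fun i hi ↦
    Int.cast_pos.2 (ev_pos hu (h2 i hi).1)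
  refine isRealRooted_of_alternating (by rwa [leadingCoeff_toPoly hlast.ne'])
    (fun i ↦ (ev u (x i).1 : ℝ) / ev u (x i).2) ?_ ?_ <;> rw [natDegree_toPoly hlast.ne']
  · intro i hi
    have h4 := ev_pos hu (h3 i (by omega))
    rw [ev_sub, ev_mul, ev_mul, sub_pos] at h4
    rw [div_lt_div_iff₀ (hden _ hi) (hden _ (by omega))]
    exact_mod_cast h4
  · intro i hi
    have h4 := ev_pos hu (h2 i hi).2
    rw [ev_smul, ← Int.cast_pos (R := ℝ), Int.cast_mul,
      ev_evalDiv_fst _ _ _ (Int.cast_ne_zero.1 (hden i hi).ne'), mul_left_comm,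
      mul_pos_iff_of_pos_left (pow_pos (hden i hi) _)] at h4
    simpa using h4

/-- Exponents of points that separate the roots of the Kazhdan–Lusztig polynomials. -/
def klExponents : List (List ℕ) :=
  [[], [], [], [], [], [4], [6], [8, 5], [10, 7], [11, 8, 4], [11, 9, 5], [12, 10, 7, 3],
    [14, 11, 8, 4], [15, 12, 8, 6, 2], [16, 13, 9, 6, 4], [16, 14, 10, 7, 5, 1]]

/-- Exponents of points that separate the roots of the `Z`-polynomials in the interval from `-1` to
`0`. -/
def zExponents : List (List ℕ) :=
  [[], [], [0], [1], [3, 0], [3, 1], [4, 2, 0], [5, 3, 1], [7, 4, 2, 0], [8, 5, 3, 1],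
    [8, 6, 3, 1, 0], [9, 7, 4, 2, 1], [11, 8, 5, 3, 1, 0], [12, 9, 6, 3, 2, 1],
    [13, 10, 6, 4, 2, 1, 0], [13, 11, 7, 5, 3, 2, 1]]

/-- The power of two with the `i`-th exponent, times a power of the order of the group for `i = 1`. -/
def separator (n : ℕ) (E : List ℕ) (i : ℕ) : List ℤ :=
  -- Only the separator of index one varies with the order `u + 1`: for `n ≥ 5` the root caught
  -- between `0` and the first nonzero point tends to `0` as the group grows.
  smul (2 ^ E.getD (i - 1) 0) (if i = 1 then pow [1, 1] (n / 5) else [1])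

/-- Points at which the signs of the Kazhdan–Lusztig polynomial alternate. -/
def klPoint (n i : ℕ) : List ℤ × List ℤ :=
  -- The numerator `-8` lets the points reach beyond `-1`, as far as `-4`, while the exponents stay
  -- natural numbers.
  if i = 0 then ([], [1]) else ([-8], separator n (klExponents.getD n []) i)

/-- Points at which the signs of the `Z`-polynomial alternate. -/
def zPoint (n i : ℕ) : List ℤ × List ℤ :=
  -- Palindromicity pairs each root with its reciprocal, so the points below `-1` are the
  -- reciprocals of those between `-1` and `0`. For even positive `n` the middle point is `-1`; for
  -- odd `n` the point `-1` is itself a root and is not used.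
  if i = 0 then ([], [1]) else if i ≤ n / 2 then ([-1], separator n (zExponents.getD n []) i)
  else (smul (-1) (separator n (zExponents.getD n []) (n - i)), [1])

set_option maxRecDepth 100000 in
-- The computational core: exact integer arithmetic on coefficient lists. This is the only place
-- where the bound on `n` enters.
lemma alternates_coeffs : ∀ n < 16,
    alternates (klCoeffs n) (klPoint n) ∧ alternates (zCoeffs n) (zPoint n) := by
  decide +kernel

end DowlingKL

/-! ## Flats of contractions -/

namespace Matroid

variable {α : Type*}

lemma IsFlat.contract_sdiff {M : Matroid α} {F K : Set α} (hK : M.IsFlat K) (hFK : F ⊆ K) :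
    (M ／ F).IsFlat (K \ F) := by
  rw [isFlat_iff_closure_eq, contract_closure_eq, Set.sdiff_union_of_subset hFK, hK.closure]

/-- The closure of `K` in `M ／ F` is the closure of `K ∪ F` in `M` with `F` removed, so adding `F`
back to a closed set gives a closed set. -/
lemma IsFlat.union_of_contract {M : Matroid α} {F K : Set α} (hF : M.IsFlat F)
    (hK : (M ／ F).IsFlat K) : M.IsFlat (K ∪ F) := by
  have h1 : K ∪ F ⊆ M.E := Set.union_subset (hK.subset_ground.trans Set.sdiff_subset)
    hF.subset_ground
  have h2 := hK.closure
  rw [contract_closure_eq] at h2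
  rw [isFlat_iff_closure_eq]
  conv_rhs => rw [← h2]
  rw [Set.sdiff_union_of_subset]
  exact Set.subset_union_right.trans (M.subset_closure _ h1)

/-- The flats of a contraction by a flat `F` are the flats above `F`. -/
def flatsContract {M : Matroid α} (F : {F : Set α // M.IsFlat F}) :
    Set.Ici F ≃o {K : Set α // (M ／ F.1).IsFlat K} where
  toFun K := ⟨K.1.1 \ F.1, K.1.2.contract_sdiff K.2⟩
  invFun K := ⟨⟨K.1 ∪ F.1, F.2.union_of_contract K.2⟩, Set.subset_union_right⟩
  left_inv K := Subtype.ext (Subtype.ext (Set.sdiff_union_of_subset K.2))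
  right_inv K := by
    have h : Disjoint K.1 F.1 := (Set.subset_sdiff.1 K.2.subset_ground).2
    exact Subtype.ext (by simpa using h.sdiff_eq_left)
  map_rel_iff' {K K'} := by
    refine ⟨fun h ↦ ?_, fun h ↦ Set.sdiff_subset_sdiff_left h⟩
    have h1 : K.1.1 \ F.1 ⊆ K'.1.1 \ F.1 := h
    have h2 : K.1.1 ⊆ K'.1.1 := by
      rw [← Set.sdiff_union_of_subset K.2, ← Set.sdiff_union_of_subset K'.2]
      exact Set.union_subset_union_left _ h1
    exact h2

/-- Contracting `K` at once, or `F` and then `K \ F`, gives the same matroid; comparing the ranks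
lost on the two routes proves the identity. -/
lemma natRk_contract_sdiff [Finite α] {M : Matroid α} {F K : Set α} (hF : M.IsFlat F)
    (hK : M.IsFlat K) (hFK : F ⊆ K) : M.natRk F + (M ／ F).natRk (K \ F) = M.natRk K := by
  have h1 := natRk_add_natRank_contract hF
  have h2 := natRk_add_natRank_contract hK
  have h3 := natRk_add_natRank_contract (hK.contract_sdiff hFK)
  rw [contract_contract, Set.union_sdiff_cancel hFK] at h3
  omega

end Matroid

/-! ## Upper intervals of Dowling lattices -/

namespace PartialGPartition

variable {n k : ℕ} {G : Type*} [Group G]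

/-- The coarsening of `p` given by a partial `G`-partition of its set of blocks. -/
def coarsen (p : PartialGPartition n G) (b : Quotient p.blocks ≃ Fin k)
    (q : PartialGPartition k G) : PartialGPartition n G where
  carrier := {i | ∃ h : i ∈ p.carrier, b ⟦⟨i, h⟩⟧ ∈ q.carrier}
  label i := q.label ⟨b ⟦⟨i.1, i.2.1⟩⟧, i.2.2⟩ * p.label ⟨i.1, i.2.1⟩
  blocks := q.blocks.comap fun i ↦ ⟨b ⟦⟨i.1, i.2.1⟩⟧, i.2.2⟩

variable {p : PartialGPartition n G} {b : Quotient p.blocks ≃ Fin k} {q q' : PartialGPartition k G}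

lemma mem_coarsen {i : Fin n} (hi : i ∈ p.carrier) :
    i ∈ (p.coarsen b q).carrier ↔ b ⟦⟨i, hi⟩⟧ ∈ q.carrier :=
  ⟨fun ⟨_, h⟩ ↦ h, fun h ↦ ⟨hi, h⟩⟩

lemma coarsen_rel {i j : Fin n} (hi : i ∈ p.carrier) (hj : j ∈ p.carrier) :
    (p.coarsen b q).Rel i j ↔ q.Rel (b ⟦⟨i, hi⟩⟧) (b ⟦⟨j, hj⟩⟧) :=
  ⟨fun ⟨h1, h2, h⟩ ↦ ⟨h1.2, h2.2, h⟩, fun ⟨h1, h2, h⟩ ↦ ⟨⟨hi, h1⟩, ⟨hj, h2⟩, h⟩⟩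

/-- Labels of blocks multiply labels of letters from the left, so the labels of `p` can be moved
into `g`. Edges between letters thus become edges between blocks, and order relations transfer in
both directions. -/
lemma coarsen_edge {i j : Fin n} {g : G} (hi : i ∈ p.carrier) (hj : j ∈ p.carrier) :
    (p.coarsen b q).Edge i j g ↔ q.Edge (b ⟦⟨i, hi⟩⟧) (b ⟦⟨j, hj⟩⟧)
      (p.label ⟨i, hi⟩ * g * (p.label ⟨j, hj⟩)⁻¹) := by
  unfold Edge
  refine or_congr (and_congr (not_congr (mem_coarsen hi)) (not_congr (mem_coarsen hj))) ⟨?_, ?_⟩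
  · rintro ⟨h1, h2, h3, h4⟩
    refine ⟨h1.2, h2.2, (coarsen_rel hi hj).1 h3, ?_⟩
    change q.label _ * p.label _ * g = q.label _ * p.label _ at h4
    rw [← mul_assoc, ← mul_assoc, h4, mul_inv_cancel_right]
  · rintro ⟨h1, h2, h3, h4⟩
    refine ⟨⟨hi, h1⟩, ⟨hj, h2⟩, (coarsen_rel hi hj).2 h3, ?_⟩
    change q.label _ * p.label _ * g = q.label _ * p.label _
    rw [← mul_assoc, ← mul_assoc, mul_inv_eq_iff_eq_mul] at h4
    exact h4

lemma le_coarsen : p.Le (p.coarsen b q) := by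
  refine ⟨fun i hi h ↦ hi h.1, ?_⟩
  rintro i j g (⟨hi, hj⟩ | ⟨hi, hj, hr, he⟩)
  · exact .inl ⟨fun h ↦ hi h.1, fun h ↦ hj h.1⟩
  · rw [coarsen_edge hi hj, he, mul_inv_cancel,
      show (⟦⟨j, hj⟩⟧ : Quotient p.blocks) = ⟦⟨i, hi⟩⟧ from Quotient.sound hr.symm.2.2]
    exact edge_refl _

lemma coarsen_le_coarsen : (p.coarsen b q).Le (p.coarsen b q') ↔ q.Le q' := by
  have hb : ∀ c, ∃ i, ∃ hi : i ∈ p.carrier, b ⟦⟨i, hi⟩⟧ = c := by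
    intro c
    obtain ⟨⟨i, hi⟩, h⟩ := Quotient.exists_rep (b.symm c)
    exact ⟨i, hi, by rw [h, b.apply_symm_apply]⟩
  constructor
  · intro h
    refine ⟨fun c hc ↦ ?_, fun c d g hg ↦ ?_⟩
    · obtain ⟨i, hi, rfl⟩ := hb c
      rw [← mem_coarsen hi] at hc ⊢
      exact h.1 i hc
    · obtain ⟨i, hi, rfl⟩ := hb c
      obtain ⟨j, hj, rfl⟩ := hb d
      have := h.2 i j ((p.label ⟨i, hi⟩)⁻¹ * g * p.label ⟨j, hj⟩)
      rw [coarsen_edge hi hj, coarsen_edge hi hj] at this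
      simpa [mul_assoc] using this (by simpa [mul_assoc] using hg)
  · intro h
    have key : ∀ i, i ∉ (p.coarsen b q).carrier → i ∉ (p.coarsen b q').carrier :=
      fun i hi hi' ↦ h.1 _ (fun hc ↦ hi ⟨hi'.1, hc⟩) hi'.2
    refine ⟨key, fun i j g hg ↦ ?_⟩
    by_cases hi : i ∈ (p.coarsen b q).carrier
    · have hj := hg.mem hi
      rw [coarsen_edge hi.1 hj.1] at hg ⊢
      exact h.2 _ _ _ hg
    · exact edge_of_notMem (key i hi) (key j (hg.notMem hi))

lemma numBlocks_coarsen : (p.coarsen b q).numBlocks = q.numBlocks := by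
  refine Nat.card_congr (Equiv.ofBijective (Quotient.map' (fun i ↦ ⟨b ⟦⟨i.1, i.2.1⟩⟧, i.2.2⟩)
    fun _ _ h ↦ h) ⟨?_, ?_⟩)
  · intro x y
    induction x using Quotient.inductionOn' with
    | h i =>
      induction y using Quotient.inductionOn' with
      | h j =>
        intro h
        have h' : q.blocks ⟨b ⟦⟨i.1, i.2.1⟩⟧, i.2.2⟩ ⟨b ⟦⟨j.1, j.2.1⟩⟧, j.2.2⟩ := Quotient.exact h
        exact Quotient.sound' h'
  · intro x
    induction x using Quotient.inductionOn' with
    | h c =>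
      obtain ⟨c, hc⟩ := c
      obtain ⟨⟨i, hi⟩, h⟩ := Quotient.exists_rep (b.symm c)
      have h' : b ⟦⟨i, hi⟩⟧ = c := by rw [h, b.apply_symm_apply]
      subst h'
      exact ⟨Quotient.mk'' ⟨i, hi, hc⟩, rfl⟩

/-- Each block of `p` lies in one block of `p'` or entirely outside its subset, and there the labels
change by a common left factor. So `p'` can be recovered from one representative per block. -/
lemma exists_coarsen (b : Quotient p.blocks ≃ Fin k) {p' : PartialGPartition n G} (h : p.Le p') :
    ∃ q, (p.coarsen b q).Equivalent p' := by
  let r : Fin k → p.carrier := fun c ↦ (b.symm c).out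
  have hr : ∀ i (hi : i ∈ p.carrier), p.Rel i (r (b ⟦⟨i, hi⟩⟧)) := by
    intro i hi
    refine ⟨hi, (r _).2, Quotient.exact ?_⟩
    simp [r]
  let q : PartialGPartition k G :=
    { carrier := {c | (r c).1 ∈ p'.carrier}
      -- The left factor carrying the label in `p` of the representative to its label in `p'`.
      label := fun c ↦ p'.label ⟨(r c.1).1, c.2⟩ * (p.label (r c.1))⁻¹
      blocks := p'.blocks.comap fun c ↦ ⟨(r c.1).1, c.2⟩ }
  have hq : ∀ c d g, q.Edge c d g ↔
      p'.Edge (r c) (r d) ((p.label (r c))⁻¹ * g * p.label (r d)) := by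
    intro c d g
    unfold Edge
    refine or_congr Iff.rfl ⟨?_, ?_⟩
    · rintro ⟨h1, h2, ⟨_, _, h3⟩, h4⟩
      refine ⟨h1, h2, ⟨h1, h2, h3⟩, ?_⟩
      change p'.label _ * _ * g = p'.label _ * _ at h4
      rw [← mul_assoc, ← mul_assoc, h4, inv_mul_cancel_right]
    · rintro ⟨h1, h2, ⟨_, _, h3⟩, h4⟩
      refine ⟨h1, h2, ⟨h1, h2, h3⟩, ?_⟩
      change p'.label _ * _ * g = p'.label _ * _
      rw [← mul_assoc, ← mul_assoc, ← eq_mul_inv_iff_mul_eq] at h4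
      exact h4
  have hmem : ∀ i, i ∈ (p.coarsen b q).carrier ↔ i ∈ p'.carrier := by
    intro i
    constructor
    · rintro ⟨hi, hc⟩
      exact (h.2 _ _ _ (edge_of_rel (hr i hi))).symm.mem hc
    · intro hi
      exact ⟨h.mem hi, (h.2 _ _ _ (edge_of_rel (hr i (h.mem hi)))).mem hi⟩
  have hedge : ∀ i j g, (p.coarsen b q).Edge i j g ↔ p'.Edge i j g := by
    intro i j g
    by_cases hi : i ∈ p'.carrier
    · by_cases hj : j ∈ p'.carrier
      · have hi' := h.mem hi
        have hj' := h.mem hj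
        have e1 := h.2 _ _ _ (edge_of_rel (hr i hi'))
        have e2 := h.2 _ _ _ (edge_of_rel (hr j hj'))
        rw [coarsen_edge hi' hj', hq]
        constructor
        · intro e3
          simpa [mul_assoc] using (e1.trans e3).trans e2.symm
        · intro e3
          simpa [mul_assoc] using (e1.symm.trans e3).trans e2
      · exact ⟨fun e ↦ absurd ((hmem j).1 (e.mem ((hmem i).2 hi))) hj,
          fun e ↦ absurd (e.mem hi) hj⟩
    · have hi' := mt (hmem i).1 hi
      exact ⟨fun e ↦ edge_of_notMem hi (mt (hmem j).2 (e.notMem hi')),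
        fun e ↦ edge_of_notMem hi' (mt (hmem j).1 (e.notMem hi))⟩
  exact ⟨q, equivalent_iff.2 ⟨⟨fun i ↦ mt (hmem i).2, fun i j g ↦ (hedge i j g).1⟩,
    ⟨fun i ↦ mt (hmem i).1, fun i j g ↦ (hedge i j g).2⟩⟩⟩

end PartialGPartition

namespace DowlingLattice

open PartialGPartition

variable {n : ℕ} {G : Type*} [Group G]

lemma mk_eq_mk {p q : PartialGPartition n G} : mk p = mk q ↔ p.Equivalent q :=
  ⟨fun h ↦ Quotient.exact h, fun h ↦ Quotient.sound h⟩

/-- The elements above an element with `k` blocks form a Dowling lattice on `k` letters. -/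
theorem exists_ici_orderIso (x : DowlingLattice n G) :
    ∃ e : DowlingLattice x.numBlocks G ≃o Set.Ici x, ∀ y, (e y).1.numBlocks = y.numBlocks := by
  obtain ⟨p, rfl⟩ := mk_surj x
  let b : Quotient p.blocks ≃ Fin (mk p).numBlocks := Finite.equivFin _
  let f : DowlingLattice (mk p).numBlocks G → Set.Ici (mk p) := Quotient.lift
    (fun q ↦ ⟨mk (p.coarsen b q), mk_le_mk.2 le_coarsen⟩) fun q q' h ↦ by
      have h := equivalent_iff.1 h
      exact Subtype.ext (mk_eq_mk.2 (equivalent_iff.2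
        ⟨coarsen_le_coarsen.2 h.1, coarsen_le_coarsen.2 h.2⟩))
  have hf : ∀ q, (f (mk q)).1 = mk (p.coarsen b q) := fun q ↦ rfl
  have hle : ∀ y z, f y ≤ f z ↔ y ≤ z := by
    intro y z
    obtain ⟨q, rfl⟩ := mk_surj y
    obtain ⟨q', rfl⟩ := mk_surj z
    rw [← Subtype.coe_le_coe, hf, hf, mk_le_mk, mk_le_mk, coarsen_le_coarsen]
  have hs : Function.Surjective f := by
    rintro ⟨y, hy⟩
    obtain ⟨p', rfl⟩ := mk_surj y
    obtain ⟨q, hq⟩ := exists_coarsen b (mk_le_mk.1 hy)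
    exact ⟨mk q, Subtype.ext (mk_eq_mk.2 hq)⟩
  refine ⟨RelIso.ofSurjective (OrderEmbedding.ofMapLEIff f hle) hs, fun y ↦ ?_⟩
  obtain ⟨q, rfl⟩ := mk_surj y
  exact numBlocks_coarsen

end DowlingLattice

/-! ## Sums over Dowling lattices -/

namespace PartialGPartition

variable {n : ℕ} {G : Type*}

/-- The restriction to the first `n` letters. -/
def init (q : PartialGPartition (n + 1) G) : PartialGPartition n G where
  carrier := {i | i.castSucc ∈ q.carrier}
  label i := q.label ⟨i.1.castSucc, i.2⟩
  blocks := q.blocks.comap fun i ↦ ⟨i.1.castSucc, i.2⟩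

variable [Group G]

lemma init_le_init {q q' : PartialGPartition (n + 1) G} (h : q.Le q') : q.init.Le q'.init :=
  ⟨fun i ↦ h.1 i.castSucc, fun i j g ↦ h.2 i.castSucc j.castSucc g⟩

open Classical in
/-- Add a new letter as a singleton block. -/
noncomputable def snoc (p : PartialGPartition n G) : PartialGPartition (n + 1) G where
  -- The condition is vacuous for the last letter, which therefore belongs to the subset.
  carrier := {i | ∀ j, j.castSucc = i → j ∈ p.carrier}
  label i := if h : i.1 = Fin.last n then 1 else
    p.label ⟨i.1.castPred h, i.2 _ (Fin.castSucc_castPred _ h)⟩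
  blocks :=
    { r := fun i j ↦ i = j ∨ ∃ k l, k.castSucc = i.1 ∧ l.castSucc = j.1 ∧ p.Rel k l
      iseqv := by
        refine ⟨fun i ↦ .inl rfl, ?_, ?_⟩
        · rintro i j (rfl | ⟨k, l, hk, hl, h⟩)
          · exact .inl rfl
          · exact .inr ⟨l, k, hl, hk, h.symm⟩
        · rintro i j k (rfl | ⟨a, b, ha, hb, h⟩) (rfl | ⟨c, d, hc, hd, h'⟩)
          · exact .inl rfl
          · exact .inr ⟨c, d, hc, hd, h'⟩
          · exact .inr ⟨a, b, ha, hb, h⟩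
          · obtain rfl := Fin.castSucc_injective n (hb.trans hc.symm)
            exact .inr ⟨a, d, ha, hd, h.trans h'⟩ }

variable {p p' : PartialGPartition n G} {q q' : PartialGPartition (n + 1) G}

lemma last_mem_snoc : Fin.last n ∈ p.snoc.carrier :=
  fun j hj ↦ absurd hj (Fin.castSucc_ne_last j)

lemma castSucc_mem_snoc {i : Fin n} : i.castSucc ∈ p.snoc.carrier ↔ i ∈ p.carrier := by
  refine ⟨fun h ↦ h i rfl, fun h j hj ↦ ?_⟩
  rwa [Fin.castSucc_injective n hj]

lemma snoc_rel_castSucc {i j : Fin n} : p.snoc.Rel i.castSucc j.castSucc ↔ p.Rel i j := by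
  constructor
  · rintro ⟨hi, hj, h | ⟨k, l, hk, hl, h⟩⟩
    · obtain rfl := Fin.castSucc_injective n (congrArg Subtype.val h)
      exact rel_refl (castSucc_mem_snoc.1 hi)
    · obtain rfl := Fin.castSucc_injective n hk
      obtain rfl := Fin.castSucc_injective n hl
      exact h
  · exact fun h ↦ ⟨castSucc_mem_snoc.2 h.left, castSucc_mem_snoc.2 h.right,
      .inr ⟨i, j, rfl, rfl, h⟩⟩

lemma not_snoc_rel_last {i : Fin n} : ¬ p.snoc.Rel i.castSucc (Fin.last n) := by
  rintro ⟨_, _, h | ⟨k, l, _, hl, _⟩⟩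
  · exact Fin.castSucc_ne_last i (congrArg Subtype.val h)
  · exact Fin.castSucc_ne_last l hl

lemma snoc_edge_castSucc {i j : Fin n} {g : G} :
    p.snoc.Edge i.castSucc j.castSucc g ↔ p.Edge i j g := by
  unfold Edge
  refine or_congr (and_congr (not_congr castSucc_mem_snoc) (not_congr castSucc_mem_snoc)) ⟨?_, ?_⟩
  · rintro ⟨h1, h2, h3, h4⟩
    refine ⟨castSucc_mem_snoc.1 h1, castSucc_mem_snoc.1 h2, snoc_rel_castSucc.1 h3, ?_⟩
    simpa [snoc] using h4
  · rintro ⟨h1, h2, h3, h4⟩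
    refine ⟨castSucc_mem_snoc.2 h1, castSucc_mem_snoc.2 h2, snoc_rel_castSucc.2 h3, ?_⟩
    simpa [snoc] using h4

/-- An adjunction: a new singleton block imposes no condition on `q`. Hence every `q` restricting to
the class of `p` lies above `p.snoc`. -/
lemma snoc_le_iff : p.snoc.Le q ↔ p.Le q.init := by
  constructor
  · intro h
    exact ⟨fun i hi ↦ h.1 i.castSucc (mt castSucc_mem_snoc.1 hi),
      fun i j g hg ↦ h.2 _ _ _ (snoc_edge_castSucc.2 hg)⟩
  · intro h
    have hmem : ∀ i, i ∉ p.snoc.carrier → i ∉ q.carrier := by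
      intro i
      induction i using Fin.lastCases with
      | last => exact fun hi ↦ absurd last_mem_snoc hi
      | cast i => exact fun hi ↦ h.1 i (mt castSucc_mem_snoc.2 hi)
    refine ⟨hmem, fun i j g hg ↦ ?_⟩
    by_cases hi : i ∈ p.snoc.carrier
    · have hr := hg.rel hi
      induction i using Fin.lastCases with
      | last =>
        induction j using Fin.lastCases with
        | last =>
          rw [hg.unique (edge_refl _) hi]
          exact edge_refl _
        | cast j => exact absurd hr.symm not_snoc_rel_last
      | cast i =>
        induction j using Fin.lastCases with
        | last => exact absurd hr not_snoc_rel_last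
        | cast j => exact h.2 _ _ _ (snoc_edge_castSucc.1 hg)
    · exact edge_of_notMem (hmem i hi) (hmem j (hg.notMem hi))

lemma numBlocks_snoc : p.snoc.numBlocks = p.numBlocks + 1 := by
  unfold numBlocks
  rw [← Finite.card_option]
  refine (Nat.card_congr (Equiv.ofBijective (fun c : Option (Quotient p.blocks) ↦
    c.elim (⟦⟨Fin.last n, last_mem_snoc⟩⟧ : Quotient p.snoc.blocks)
      (Quotient.lift (fun i ↦ ⟦⟨i.1.castSucc, castSucc_mem_snoc.2 i.2⟩⟧) fun i j h ↦
        Quotient.sound (.inr ⟨i, j, rfl, rfl, i.2, j.2, h⟩))) ⟨?_, ?_⟩)).symm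
  · have key : ∀ i : p.carrier, (⟦⟨i.1.castSucc, castSucc_mem_snoc.2 i.2⟩⟧ :
        Quotient p.snoc.blocks) ≠ ⟦⟨Fin.last n, last_mem_snoc⟩⟧ :=
      fun i h ↦ not_snoc_rel_last ⟨_, _, Quotient.exact h⟩
    rintro (_ | c) (_ | d) h
    · rfl
    · induction d using Quotient.inductionOn with
      | h i => exact absurd h.symm (key i)
    · induction c using Quotient.inductionOn with
      | h i => exact absurd h (key i)
    · induction c using Quotient.inductionOn with
      | h i =>
        induction d using Quotient.inductionOn with
        | h j =>
          have h' : p.Rel i j := snoc_rel_castSucc.1 ⟨_, _, Quotient.exact h⟩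
          exact congrArg some (Quotient.sound h'.2.2)
  · intro c
    induction c using Quotient.inductionOn with
    | h i =>
      obtain ⟨i, hi⟩ := i
      induction i using Fin.lastCases with
      | last => exact ⟨none, rfl⟩
      | cast i => exact ⟨some ⟦⟨i, castSucc_mem_snoc.1 hi⟩⟧, rfl⟩

/-- Labels need no separate comparison: each edge of `p` persists in `p'`, and the label of an edge
inside the subset is unique. -/
lemma Le.equivalent_of_rel (h : p.Le p') (hc : ∀ i ∈ p.carrier, i ∈ p'.carrier)
    (hr : ∀ i j, p'.Rel i j → p.Rel i j) : p.Equivalent p' := by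
  refine equivalent_iff.2 ⟨h, fun i ↦ mt (hc i), fun i j g hg ↦ ?_⟩
  by_cases hi : i ∈ p'.carrier
  · have h1 := edge_of_rel (hr i j (hg.rel hi))
    rwa [(h.2 _ _ _ h1).unique hg hi] at h1
  · exact edge_of_notMem (mt (hc i) hi) (mt (hc j) (hg.notMem hi))

/-- Add a new letter: outside of the subset, as a singleton block, or in an old block. -/
noncomputable def extend (p : PartialGPartition n G) :
    Option (Option (Quotient p.blocks × G)) → PartialGPartition (n + 1) G
  | none => p.snoc.del (Fin.last n)
  | some none => p.snoc
  | some (some (c, g)) =>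
    p.snoc.join c.out.1.castSucc (Fin.last n) (castSucc_mem_snoc.2 c.out.2) last_mem_snoc g

lemma snoc_le_extend (o : Option (Option (Quotient p.blocks × G))) : p.snoc.Le (p.extend o) := by
  obtain _ | _ | ⟨c, g⟩ := o
  · exact (isDeletion_del last_mem_snoc).le
  · exact .refl _
  · exact le_join _ _ not_snoc_rel_last

lemma castSucc_mem_extend {o : Option (Option (Quotient p.blocks × G))} {i : Fin n} :
    i.castSucc ∈ (p.extend o).carrier ↔ i ∈ p.carrier := by
  obtain _ | _ | ⟨c, g⟩ := o
  · refine ⟨fun h ↦ castSucc_mem_snoc.1 h.1, fun h ↦ ⟨castSucc_mem_snoc.2 h, fun hr ↦ ?_⟩⟩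
    exact not_snoc_rel_last hr.symm
  · exact castSucc_mem_snoc
  · exact castSucc_mem_snoc

lemma join_rel {i j k l : Fin n} {hi : i ∈ p.carrier} {hj : j ∈ p.carrier} {g : G} :
    (p.join i j hi hj g).Rel k l ↔
      p.Rel k l ∨ (p.Rel i k ∨ p.Rel j k) ∧ (p.Rel i l ∨ p.Rel j l) :=
  merge_rel

lemma extend_rel_castSucc {o : Option (Option (Quotient p.blocks × G))} {i j : Fin n} :
    (p.extend o).Rel i.castSucc j.castSucc ↔ p.Rel i j := by
  obtain _ | _ | ⟨c, g⟩ := o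
  · refine del_rel.trans (Iff.trans (and_iff_left ?_) snoc_rel_castSucc)
    exact fun hr ↦ not_snoc_rel_last hr.symm
  · exact snoc_rel_castSucc
  · have h : ∀ i : Fin n, ¬ p.snoc.Rel (Fin.last n) i.castSucc :=
      fun i hr ↦ not_snoc_rel_last hr.symm
    refine join_rel.trans ?_
    simp only [h, or_false, snoc_rel_castSucc]
    exact ⟨fun h ↦ h.elim id fun h ↦ h.1.symm.trans h.2, .inl⟩

lemma equivalent_init_extend (o : Option (Option (Quotient p.blocks × G))) :
    p.Equivalent (p.extend o).init :=
  (snoc_le_iff.1 (snoc_le_extend o)).equivalent_of_rel (fun _ hi ↦ castSucc_mem_extend.2 hi)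
    fun _ _ h ↦ extend_rel_castSucc.1 h

open Classical in
-- Anything strictly above `p.snoc` has fewer blocks, and a single deletion or join loses at most
-- one. So every extension other than the singleton has exactly as many blocks as `p`.
lemma numBlocks_extend (o : Option (Option (Quotient p.blocks × G))) :
    (p.extend o).numBlocks = if o = some none then p.numBlocks + 1 else p.numBlocks := by
  have key : ∀ {q : PartialGPartition (n + 1) G}, p.snoc.Le q → ¬ q.Le p.snoc →
      p.snoc.numBlocks ≤ q.numBlocks + 1 → q.numBlocks = p.numBlocks := by
    intro q h1 h2 h3
    have h4 : q.numBlocks < p.snoc.numBlocks := by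
      by_contra hc
      exact h2 (h1.le_of_numBlocks_le (not_lt.1 hc))
    rw [numBlocks_snoc] at h3 h4
    omega
  obtain _ | _ | ⟨c, g⟩ := o
  · rw [if_neg (by simp)]
    refine key (snoc_le_extend none) (fun h ↦ ?_) (numBlocks_le_del last_mem_snoc)
    exact h.1 (Fin.last n) (fun h' ↦ h'.2 (rel_refl last_mem_snoc)) last_mem_snoc
  · rw [if_pos rfl]
    exact numBlocks_snoc
  · rw [if_neg (by simp)]
    refine key (snoc_le_extend _) (fun h ↦ ?_)
      (numBlocks_le_join (castSucc_mem_snoc.2 c.out.2) last_mem_snoc)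
    exact not_snoc_rel_last ((h.2 _ _ _ (join_edge (g := g) (castSucc_mem_snoc.2 c.out.2)
      last_mem_snoc not_snoc_rel_last)).rel (castSucc_mem_snoc.2 c.out.2))

lemma extend_injective {o o' : Option (Option (Quotient p.blocks × G))}
    (h : (p.extend o).Equivalent (p.extend o')) : o = o' := by
  have hnone : ∀ {o : Option (Quotient p.blocks × G)},
      ¬ (p.extend none).Equivalent (p.extend (some o)) := by
    intro o h
    have h1 : Fin.last n ∉ (p.extend none).carrier := fun h' ↦ h'.2 (rel_refl last_mem_snoc)
    rw [h.1] at h1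
    cases o <;> exact h1 last_mem_snoc
  have hedge : ∀ c g, (p.extend (some (some (c, g)))).Edge c.out.1.castSucc (Fin.last n) g :=
    fun c g ↦ join_edge _ _ not_snoc_rel_last
  have hsnoc : ∀ {c : Quotient p.blocks × G},
      ¬ (p.extend (some none)).Equivalent (p.extend (some (some c))) := by
    rintro ⟨c, g⟩ h
    exact not_snoc_rel_last (((equivalent_iff.1 h).2.2 _ _ _ (hedge c g)).rel
      (castSucc_mem_snoc.2 c.out.2))
  have h' := equivalent_iff.2 (equivalent_iff.1 h).symm
  obtain _ | _ | ⟨c, g⟩ := o <;> obtain _ | _ | ⟨d, g'⟩ := o'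
  · rfl
  · exact absurd h hnone
  · exact absurd h hnone
  · exact absurd h' hnone
  · rfl
  · exact absurd h hsnoc
  · exact absurd h' hnone
  · exact absurd h' hsnoc
  · have h1 := (equivalent_iff.1 h).1.2 _ _ _ (hedge c g)
    have h2 := hedge d g'
    have hc : c.out.1.castSucc ∈ (p.extend (some (some (d, g')))).carrier :=
      castSucc_mem_extend.2 c.out.2
    -- Passing through the new letter puts the representatives of `c` and `d` into one block, and
    -- extensions do not merge old blocks.
    have hcd : c = d := by
      have h3 : p.Rel c.out d.out := extend_rel_castSucc.1 ((h1.trans h2.symm).rel hc)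
      rw [← c.out_eq, ← d.out_eq]
      exact Quotient.sound h3.2.2
    subst hcd
    rw [h1.unique h2 hc]

/-- The new letter is outside the subset of `q`, is alone in its block, or shares its block with an
old letter. In the last case the label is read off from the edge joining the chosen representative
of that block to the new letter. -/
lemma exists_extend (h : p.Equivalent q.init) : ∃ o, (p.extend o).Equivalent q := by
  have hle := (equivalent_iff.1 h).1
  have hsnoc : p.snoc.Le q := snoc_le_iff.2 hle
  have hmem : ∀ {i : Fin n}, i ∈ p.carrier ↔ i.castSucc ∈ q.carrier := by
    intro i
    rw [h.1]
    rfl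
  have hrel : ∀ {i j : Fin n}, p.Rel i j ↔ q.Rel i.castSucc j.castSucc := h.2.1 _ _
  by_cases hl : Fin.last n ∈ q.carrier
  · by_cases hi : ∃ i : Fin n, q.Rel i.castSucc (Fin.last n)
    · obtain ⟨i, hi⟩ := hi
      let c : Quotient p.blocks := ⟦⟨i, hmem.2 hi.left⟩⟧
      have hc : p.Rel c.out i := ⟨c.out.2, hmem.2 hi.left, Quotient.exact c.out_eq⟩
      have hcl : q.Rel c.out.1.castSucc (Fin.last n) := (hrel.1 hc).trans hi
      refine ⟨some (some (c, _)), Le.equivalent_of_rel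
        ((join_le_iff _ _ not_snoc_rel_last).2 ⟨hsnoc, edge_of_rel hcl⟩) ?_ ?_⟩
      · intro j hj
        induction j using Fin.lastCases with
        | last => exact hl
        | cast j => exact hmem.1 (castSucc_mem_extend.1 hj)
      · have key : ∀ j, q.Rel j (Fin.last n) →
            p.snoc.Rel c.out.1.castSucc j ∨ p.snoc.Rel (Fin.last n) j := by
          intro j hj
          induction j using Fin.lastCases with
          | last => exact .inr (rel_refl last_mem_snoc)
          | cast j => exact .inl (snoc_rel_castSucc.2 (hrel.2 (hcl.trans hj.symm)))
        intro j k hjk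
        by_cases hj : q.Rel j (Fin.last n)
        · exact join_rel.2 (.inr ⟨key j hj, key k (hjk.symm.trans hj)⟩)
        · induction j using Fin.lastCases with
          | last => exact absurd (rel_refl hl) hj
          | cast j =>
            induction k using Fin.lastCases with
            | last => exact absurd hjk hj
            | cast k => exact extend_rel_castSucc.2 (hrel.2 hjk)
    · push Not at hi
      refine ⟨some none, hsnoc.equivalent_of_rel ?_ ?_⟩
      · intro j hj
        induction j using Fin.lastCases with
        | last => exact hl
        | cast j => exact hmem.1 (castSucc_mem_snoc.1 hj)
      · intro j k hjk
        induction j using Fin.lastCases with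
        | last =>
          induction k using Fin.lastCases with
          | last => exact rel_refl last_mem_snoc
          | cast k => exact absurd hjk.symm (hi k)
        | cast j =>
          induction k using Fin.lastCases with
          | last => exact absurd hjk (hi j)
          | cast k => exact snoc_rel_castSucc.2 (hrel.2 hjk)
  · refine ⟨none, Le.equivalent_of_rel ((del_le_iff last_mem_snoc).2 ⟨hsnoc, hl⟩) ?_ ?_⟩
    · intro j hj
      induction j using Fin.lastCases with
      | last => exact absurd (rel_refl last_mem_snoc) hj.2
      | cast j => exact hmem.1 (castSucc_mem_snoc.1 hj.1)
    · intro j k hjk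
      induction j using Fin.lastCases with
      | last => exact absurd hjk.left hl
      | cast j =>
        induction k using Fin.lastCases with
        | last => exact absurd hjk.right hl
        | cast k => exact extend_rel_castSucc.2 (hrel.2 hjk)

end PartialGPartition

/-! ### Counting classes by adding one letter at a time -/

namespace DowlingLattice

open PartialGPartition Polynomial DowlingKL

variable {n : ℕ} {G : Type*} [Group G]

/-- A representative of a class of partial `G`-partitions. -/
noncomputable def out (x : DowlingLattice n G) : PartialGPartition n G :=
  Quotient.out (s := PartialGPartition.setoid n G) x

lemma mk_out (x : DowlingLattice n G) : mk x.out = x :=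
  Quotient.out_eq (s := PartialGPartition.setoid n G) x

/-- The partial `G`-partitions of `n + 1` letters are obtained from those of `n` letters by adding
the new letter outside of the subset, as a singleton block, or in an old block. -/
lemma bijective_extend : Function.Bijective
    fun y : Σ x : DowlingLattice n G, Option (Option (Quotient x.out.blocks × G)) ↦
      mk (y.1.out.extend y.2) := by
  constructor
  · rintro ⟨x, o⟩ ⟨x', o'⟩ h
    have h : (x.out.extend o).Equivalent (x'.out.extend o') := mk_eq_mk.1 h
    have hx : x = x' := by
      have h1 := equivalent_iff.1 h
      have h2 : mk (x.out.extend o).init = mk (x'.out.extend o').init :=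
        mk_eq_mk.2 (equivalent_iff.2 ⟨init_le_init h1.1, init_le_init h1.2⟩)
      rw [← mk_eq_mk.2 (equivalent_init_extend o), ← mk_eq_mk.2 (equivalent_init_extend o')] at h2
      exact (mk_out x).symm.trans (h2.trans (mk_out x'))
    subst hx
    rw [extend_injective h]
  · intro y
    obtain ⟨q, rfl⟩ := mk_surj y
    have h : (mk q.init).out.Equivalent q.init := mk_eq_mk.1 (mk_out _)
    obtain ⟨o, ho⟩ := exists_extend h
    exact ⟨⟨mk q.init, o⟩, mk_eq_mk.2 ho⟩

/-- Over a class with `k` blocks there are `1 + m k` extensions that keep `k` blocks, namely one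
deletion and `m k` joins, and one with `k + 1` blocks. -/
lemma finsum_numBlocks_succ [Finite G] (F : ℕ → ℤ[X]) :
    ∑ᶠ y : DowlingLattice (n + 1) G, F y.numBlocks = ∑ᶠ x : DowlingLattice n G,
      (C (1 + (Nat.card G : ℤ) * x.numBlocks) * F x.numBlocks + F (x.numBlocks + 1)) := by
  classical
  have := Fintype.ofFinite G
  have := Fintype.ofFinite (DowlingLattice n G)
  have := Fintype.ofFinite (DowlingLattice (n + 1) G)
  have := fun x : DowlingLattice n G ↦ Fintype.ofFinite (Quotient x.out.blocks)
  rw [finsum_eq_sum_of_fintype, finsum_eq_sum_of_fintype,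
    ← (Equiv.ofBijective _ bijective_extend).sum_comp, Fintype.sum_sigma]
  refine Finset.sum_congr rfl fun x _ ↦ ?_
  have hx : x.numBlocks = x.out.numBlocks := by
    conv_lhs => rw [← mk_out x]
    rfl
  have hy : ∀ o, (mk (x.out.extend o)).numBlocks =
      if o = some none then x.numBlocks + 1 else x.numBlocks := by
    intro o
    rw [hx]
    exact numBlocks_extend o
  have hcard : Fintype.card (Quotient x.out.blocks) = x.numBlocks := by
    rw [hx, PartialGPartition.numBlocks, Nat.card_eq_fintype_card]
  simp only [Equiv.ofBijective_apply, hy, Fintype.sum_option, reduceCtorEq, if_false, if_true,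
    Option.some.injEq, Finset.sum_const, Finset.card_univ, Fintype.card_prod, hcard,
    Nat.card_eq_fintype_card, nsmul_eq_mul]
  simp only [Nat.cast_mul, eq_intCast, Int.cast_add, Int.cast_mul, Int.cast_natCast, Int.cast_one]
  ring

instance : Unique (DowlingLattice 0 G) where
  default := ⊥
  uniq x := by
    obtain ⟨p, rfl⟩ := mk_surj x
    exact (eq_of_rank_le bot_le (by simp [rank])).symm

theorem finsum_dowlingLattice [Finite G] (n : ℕ) (f : ℕ → ℤ[X]) :
    ∑ᶠ x : DowlingLattice n G, X ^ x.rank * f x.numBlocks =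
      (latticeOp (Nat.card G))^[n] f 0 := by
  induction n generalizing f with
  | zero =>
    rw [finsum_eq_sum_of_fintype, Fintype.sum_unique]
    have : (default : DowlingLattice 0 G).numBlocks = 0 := Nat.le_zero.1 (numBlocks_le _)
    simp [rank, this]
  | succ n ih =>
    rw [Function.iterate_succ_apply, ← ih]
    -- On `n + 1` letters the rank is `n + 1 - k`. Extensions keeping `k` blocks raise the rank by
    -- one, whence the factor `X` in `latticeOp`; a new singleton leaves it unchanged.
    refine (finsum_numBlocks_succ fun k ↦ X ^ (n + 1 - k) * f k).trans ?_
    refine finsum_congr fun x ↦ ?_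
    have hx := x.numBlocks_le
    rw [rank, latticeOp, Nat.succ_sub hx, pow_succ, Nat.add_sub_add_right]
    ring

end DowlingLattice

/-! ## Kazhdan–Lusztig polynomials of matroids whose lattice of flats is a Dowling lattice -/

namespace DowlingLattice

open PartialGPartition Polynomial DowlingKL
open scoped Matroid

variable {n : ℕ} {G : Type*} [Group G] {α : Type*} {M : Matroid α}

lemma exists_top (n : ℕ) (G : Type*) [Group G] :
    ∃ x : DowlingLattice n G, x.rank = n ∧ ∀ y, y ≤ x := by
  let p : PartialGPartition n G :=
    { carrier := ∅
      label := fun i ↦ i.2.elim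
      blocks := ⊥ }
  refine ⟨mk p, ?_, fun y ↦ ?_⟩
  · have : IsEmpty p.carrier := ⟨fun i ↦ i.2⟩
    have h : (mk p).numBlocks = 0 := Finite.card_eq_zero_iff.2 inferInstance
    rw [rank, h, Nat.sub_zero]
  · obtain ⟨q, rfl⟩ := mk_surj y
    exact mk_le_mk.2 ⟨fun i _ h ↦ h, fun i j g _ ↦ edge_of_notMem (fun h ↦ h) fun h ↦ h⟩

lemma rank_add_numBlocks (x : DowlingLattice n G) : x.rank + x.numBlocks = n :=
  Nat.sub_add_cancel x.numBlocks_le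

lemma natRank_eq (e : DowlingLattice n G ≃o {F : Set α // M.IsFlat F})
    (he : ∀ x, M.natRk (e x).1 = x.rank) : M.natRank = n := by
  obtain ⟨x, hx, hle⟩ := exists_top n G
  have h : (e x).1 = M.E := by
    refine (e x).2.subset_ground.antisymm ?_
    have := e.monotone (hle (e.symm ⟨M.E, M.ground_isFlat⟩))
    rwa [e.apply_symm_apply] at this
  rw [← hx, ← he, h, Matroid.natRk, M.eRk_ground, Matroid.natRank]

/-- The flats of the contraction form an upper interval of the lattice, which is a smaller Dowling
lattice; ranks are compared through numbers of blocks. -/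
lemma exists_contract_flats [Finite α] (e : DowlingLattice n G ≃o {F : Set α // M.IsFlat F})
    (he : ∀ x, M.natRk (e x).1 = x.rank) (x : DowlingLattice n G) :
    ∃ e' : DowlingLattice x.numBlocks G ≃o {F : Set α // (M ／ (e x).1).IsFlat F},
      ∀ y, (M ／ (e x).1).natRk (e' y).1 = y.rank := by
  obtain ⟨j, hj⟩ := exists_ici_orderIso x
  let i : Set.Ici x ≃o Set.Ici (e x) :=
    { toFun := fun y ↦ ⟨e y.1, e.monotone y.2⟩
      invFun := fun F ↦ ⟨e.symm F.1, (e.le_symm_apply).2 F.2⟩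
      left_inv := fun y ↦ Subtype.ext (e.symm_apply_apply _)
      right_inv := fun F ↦ Subtype.ext (e.apply_symm_apply _)
      map_rel_iff' := e.le_iff_le }
  refine ⟨(j.trans i).trans (Matroid.flatsContract (e x)), fun y ↦ ?_⟩
  have h1 := Matroid.natRk_contract_sdiff (e x).2 (e (j y).1).2 (e.monotone (j y).2)
  rw [he, he] at h1
  have h2 := rank_add_numBlocks (j y).1
  have h3 := rank_add_numBlocks x
  have h4 := rank_add_numBlocks y
  rw [hj] at h2
  change (M ／ (e x).1).natRk ((e (j y).1).1 \ (e x).1) = y.rank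
  omega

lemma numBlocks_lt {x : DowlingLattice n G} (hx : x ≠ ⊥) : x.numBlocks < n := by
  by_contra hc
  refine hx (eq_of_rank_le bot_le ?_).symm
  rw [rank_bot, rank]
  omega

lemma map_bot_eq (hM : M.Loopless) (e : DowlingLattice n G ≃o {F : Set α // M.IsFlat F}) :
    (e ⊥).1 = ∅ := by
  have : e ⊥ ≤ ⟨∅, Matroid.isFlat_empty hM⟩ := by
    rw [← e.le_symm_apply]
    exact bot_le
  exact Set.subset_empty_iff.1 this

lemma flatSum_eq_finsum (P : Matroid α → ℤ[X])
    (e : DowlingLattice n G ≃o {F : Set α // M.IsFlat F})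
    (he : ∀ x, M.natRk (e x).1 = x.rank) :
    Matroid.flatSum P M = ∑ᶠ x : DowlingLattice n G, X ^ x.rank * P (M ／ (e x).1) := by
  rw [Matroid.flatSum, ← finsum_comp_equiv e.toEquiv]
  exact finsum_congr fun x ↦ by rw [← he]; rfl

/-- A contraction of a Dowling geometry stays on the same type and need not be simple. The induction
therefore runs over all loopless matroids whose ranked lattice of flats is a Dowling lattice, a
class closed under contraction by flats. -/
theorem klPoly_eq [Finite α] [Finite G] {p : ℕ → ℤ[X]} (hp : IsKLSequence (Nat.card G) p)
    (hM : M.Loopless) (e : DowlingLattice n G ≃o {F : Set α // M.IsFlat F})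
    (he : ∀ x, M.natRk (e x).1 = x.rank) : M.klPoly = p n := by
  induction n using Nat.strong_induction_on generalizing M with
  | _ n ih =>
  have hr := natRank_eq e he
  rcases eq_or_ne n 0 with rfl | hn
  · rw [Matroid.klPoly_of_natRank_eq_zero M hr, hp.zero]
  -- The bottom terms, `M.klPoly` and `p n`, are split off; the other terms agree by induction,
  -- since elements above the bottom have fewer than `n` blocks.
  have hsum : Matroid.flatSum Matroid.klPoly M =
      M.klPoly + ((latticeOp (Nat.card G))^[n] p 0 - p n) := by
    classical
    have := Fintype.ofFinite (DowlingLattice n G)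
    rw [flatSum_eq_finsum _ e he, ← finsum_dowlingLattice, finsum_eq_sum_of_fintype,
      finsum_eq_sum_of_fintype, ← Finset.add_sum_erase _ _ (Finset.mem_univ ⊥),
      ← Finset.add_sum_erase (a := ⊥) _ (fun x : DowlingLattice n G ↦ X ^ x.rank * p x.numBlocks)
        (Finset.mem_univ _),
      rank_bot, numBlocks_bot, map_bot_eq hM e, Matroid.contract_empty, pow_zero, one_mul, one_mul,
      add_sub_cancel_left]
    congr 1
    refine Finset.sum_congr rfl fun x hx ↦ ?_
    obtain ⟨e', he'⟩ := exists_contract_flats e he x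
    rw [ih _ (numBlocks_lt (Finset.ne_of_mem_erase hx)) (Matroid.loopless_contract (e x).2) e' he']
  rw [Matroid.flatSum_eq _ hM, add_right_inj] at hsum
  ext i
  rw [Matroid.coeff_klPoly M (hr ▸ hn), hsum, hr, hp.coeff n hn]

theorem zPoly_eq [Finite α] [Finite G] {p : ℕ → ℤ[X]} (hp : IsKLSequence (Nat.card G) p)
    (e : DowlingLattice n G ≃o {F : Set α // M.IsFlat F})
    (he : ∀ x, M.natRk (e x).1 = x.rank) : M.zPoly = (latticeOp (Nat.card G))^[n] p 0 := by
  rw [Matroid.zPoly, flatSum_eq_finsum _ e he, ← finsum_dowlingLattice]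
  refine finsum_congr fun x ↦ ?_
  obtain ⟨e', he'⟩ := exists_contract_flats e he x
  rw [klPoly_eq hp (Matroid.loopless_contract (e x).2) e' he']

end DowlingLattice

/-- A basis of the flat of `x` has join `x`, because the lattice is atomistic, and by independence
its size is the rank of that join. -/
lemma dowlingGeometry_natRk {n : ℕ} {G : Type*} [Group G] [Finite G] (x : DowlingLattice n G) :
    (dowlingGeometry n G).natRk {a | a.1 ≤ x} = x.rank := by
  obtain ⟨I, hI⟩ := (dowlingGeometry n G).exists_isBasis {a | a.1 ≤ x} (Set.subset_univ _)
  obtain ⟨z, hz, hr⟩ := dowlingGeometry_indep_iff.1 hI.indep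
  have h1 : {a : {a : DowlingLattice n G // IsAtom a} | a.1 ≤ x} ⊆ {a | a.1 ≤ z} := by
    rw [← dowlingGeometry_closure hz]
    exact hI.subset_closure
  have h2 : z = x := by
    refine le_antisymm ((isLUB_le_iff hz).2 ?_)
      (DowlingLattice.le_of_forall_atom fun a ha hax ↦ h1 (a := ⟨a, ha⟩) hax)
    rintro _ ⟨b, hb, rfl⟩
    exact hI.subset hb
  rw [Matroid.natRk, ← hI.encard_eq_eRk, ← h2, hr]
  rfl

theorem proposition5p2 (n : ℕ) (hn : n ≤ 15) (G : Type*) [Group G] [Finite G] :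
    IsRealRooted (dowlingGeometry n G).klPoly ∧ IsRealRooted (dowlingGeometry n G).zPoly := by
  obtain ⟨e, he⟩ := dowlingGeometry_flats (n := n) (G := G)
  have hrk : ∀ x, (dowlingGeometry n G).natRk (e x).1 = x.rank := fun x ↦ by
    rw [he, dowlingGeometry_natRk]
  -- Every group order is `u + 1` with `u ≥ 0`, exactly the range on which the certificates hold.
  obtain ⟨u, hu⟩ : ∃ u : ℕ, Nat.card G = u + 1 := Nat.exists_eq_succ_of_ne_zero Nat.card_pos.ne'
  have hG : (Nat.card G : ℤ) = u + 1 := by exact_mod_cast hu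
  have hp := DowlingKL.isKLSequence_klCoeffs (u := (u : ℤ))
  rw [← hG] at hp
  obtain ⟨h1, h2⟩ := DowlingKL.alternates_coeffs n (Nat.lt_succ_of_le hn)
  rw [DowlingLattice.klPoly_eq hp dowlingGeometry_loopless e hrk, DowlingLattice.zPoly_eq hp e hrk,
    hG, ← DowlingKL.toPoly_zCoeffs]
  exact ⟨DowlingKL.isRealRooted_of_alternates (Int.natCast_nonneg u) h1,
    DowlingKL.isRealRooted_of_alternates (Int.natCast_nonneg u) h2⟩
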